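/- Let $k$ be a field; paths are composed from right to left, so $ba$ means first $a$, then $b$, and $A\text{-mod}$ denotes the category of finitely generated left $A$-modules. For $\lambda\in k$ let $T_\lambda$ be the path algebra over $k$ of the quiver with six vertices $s, m_1, m_2, m_3, m_4, t$ and arrows $a_i : s \to m_i$, $b_i : m_i \to t$ ($1\le i\le 4$), modulo the two-sided ideal generated by the relations $b_1a_1 - b_2a_2 = b_3a_3$ and $b_1a_1 - \lambda\, b_2a_2 = b_4a_4$. Let $T := T_0$ (the degenerate tubular algebra; its second relation reads $b_1a_1 = b_4a_4$). Let $S$ be the path algebra over $k$ of the quiver with six vertices $1_\pm, 2_\pm, 3_\pm$ and eight arrows $a_\pm : 1_\pm \to 2_\pm$, $c_\pm : 1_\pm \to 2_\mp$, $b_\pm : 2_\pm \to 3_\pm$, $d_\pm : 2_\pm \to 3_\mp$, modulo the two-sided ideal generated by the relations $d_\pm a_\pm = b_\mp c_\pm$ and $b_\pm a_\pm = d_\mp c_\pm$, i.e. any two paths with the same source and the same target are equal. Then $T$ and $S$ are derived equivalent: the bounded derived categories $D^b(T\text{-mod})$ and $D^b(S\text{-mod})$ are equivalent as triangulated categories.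 -/

import Mathlib

open CategoryTheory

universe u v w

/-! ### Path algebras -/

section PathAlgebra

/-- An oriented path of the quiver `V`, together with its two end points; every vertex carries a
path of length zero. -/
structure QuiverPath (V : Type v) [Quiver.{w} V] where
  /-- the starting vertex -/
  source : V
  /-- the terminal vertex -/
  target : V
  /-- the path -/
  path : Quiver.Path source target

/-- The path algebra of the quiver `V` over `k`: the `k`-vector space with basis the set of all
oriented paths. -/
def PathAlgebra (k : Type u) [Field k] (V : Type v) [Quiver.{w} V] : Type (max u v w) :=
  QuiverPath V →₀ k

namespace PathAlgebra

variable {k : Type u} [Field k] {V : Type v} [Quiver.{w} V]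

noncomputable instance : AddCommGroup (PathAlgebra k V) :=
  inferInstanceAs (AddCommGroup (QuiverPath V →₀ k))

noncomputable instance : Module k (PathAlgebra k V) :=
  inferInstanceAs (Module k (QuiverPath V →₀ k))

/-- The basis vector given by a path. -/
noncomputable def single {a b : V} (p : Quiver.Path a b) : PathAlgebra k V :=
  Finsupp.single (⟨a, b, p⟩ : QuiverPath V) (1 : k)

theorem hom_ext {M : Type*} [AddCommGroup M] [Module k M] {f g : PathAlgebra k V →ₗ[k] M}
    (h : ∀ (a b : V) (p : Quiver.Path a b), f (single p) = g (single p)) : f = g :=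
  Finsupp.lhom_ext' fun x => LinearMap.ext_ring (h x.source x.target x.path)

theorem induction_linear {P : PathAlgebra k V → Prop} (x : PathAlgebra k V)
    (zero : P 0) (add : ∀ x y, P x → P y → P (x + y)) (smul : ∀ (r : k) x, P x → P (r • x))
    (single : ∀ {a b : V} (p : Quiver.Path a b), P (PathAlgebra.single p)) : P x := by
  refine Finsupp.induction_linear (motive := P) x zero add ?_
  intro p r
  have h : (Finsupp.single p r : QuiverPath V →₀ k) = r • Finsupp.single p (1 : k) := by simp
  rw [h]
  exact smul r _ (single p.path)

/-- The unit is the sum of all paths of length zero. -/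
noncomputable instance [Fintype V] : One (PathAlgebra k V) :=
  ⟨∑ a : V, single (Quiver.Path.nil : Quiver.Path a a)⟩

theorem one_def [Fintype V] : (1 : PathAlgebra k V) = ∑ a : V, single (Quiver.Path.nil : Quiver.Path a a) := rfl

variable [DecidableEq V]

/-- The product `p * q` of two paths: first `q`, then `p` (as for composition of maps), which is
zero if `q` does not end where `p` starts. -/
noncomputable def pathMul (p q : QuiverPath V) : PathAlgebra k V :=
  if h : q.target = p.source then single (q.path.comp (p.path.cast h.symm rfl)) else 0

/-- The bilinear extension of the product of paths. -/
noncomputable def mulHom : PathAlgebra k V →ₗ[k] PathAlgebra k V →ₗ[k] PathAlgebra k V :=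
  Finsupp.linearCombination k fun p : QuiverPath V =>
    (Finsupp.linearCombination k fun q : QuiverPath V => (pathMul p q : PathAlgebra k V) :
      (QuiverPath V →₀ k) →ₗ[k] PathAlgebra k V)

noncomputable instance : Mul (PathAlgebra k V) := ⟨fun x y => mulHom x y⟩

theorem mul_def (x y : PathAlgebra k V) : x * y = mulHom x y := rfl

theorem mulHom_single {a b c d : V} (p : Quiver.Path a b) (q : Quiver.Path c d) :
    mulHom (single p : PathAlgebra k V) (single q) = pathMul ⟨a, b, p⟩ ⟨c, d, q⟩ := by
  have h : (mulHom (single p : PathAlgebra k V) : PathAlgebra k V →ₗ[k] PathAlgebra k V) =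
      (Finsupp.linearCombination k fun r : QuiverPath V =>
        (pathMul ⟨a, b, p⟩ r : PathAlgebra k V)) :=
    (Finsupp.linearCombination_single k (1 : k) (⟨a, b, p⟩ : QuiverPath V)).trans (one_smul _ _)
  rw [h]
  exact (Finsupp.linearCombination_single k (1 : k) (⟨c, d, q⟩ : QuiverPath V)).trans (one_smul _ _)

theorem single_mul_single {a b c : V} (p : Quiver.Path b c) (q : Quiver.Path a b) :
    (single p * single q : PathAlgebra k V) = single (q.comp p) := by
  rw [mul_def, mulHom_single]
  simp [pathMul]

theorem single_mul_single_of_ne {a b c d : V} (p : Quiver.Path a b) (q : Quiver.Path c d)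
    (h : d ≠ a) : (single p * single q : PathAlgebra k V) = 0 := by
  rw [mul_def, mulHom_single]
  simp [pathMul, h]


theorem single_mul_assoc {a b c d e f : V} (p : Quiver.Path a b) (q : Quiver.Path c d)
    (r : Quiver.Path e f) :
    (single p * single q * single r : PathAlgebra k V) = single p * (single q * single r) := by
  by_cases h₁ : d = a
  · subst h₁
    by_cases h₂ : f = c
    · subst h₂
      simp only [single_mul_single, Quiver.Path.comp_assoc]
    · rw [single_mul_single, single_mul_single_of_ne _ _ h₂, single_mul_single_of_ne _ _ h₂]
      simp [mul_def]
  · rw [single_mul_single_of_ne _ _ h₁]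
    by_cases h₂ : f = c
    · subst h₂
      rw [single_mul_single, single_mul_single_of_ne _ _ h₁]
      simp [mul_def]
    · rw [single_mul_single_of_ne _ _ h₂]
      simp [mul_def]

variable [Fintype V]

theorem one_mul_single {a b : V} (p : Quiver.Path a b) :
    (mulHom 1 (single p) : PathAlgebra k V) = single p := by
  rw [one_def, map_sum, LinearMap.sum_apply, Finset.sum_eq_single b]
  · rw [← mul_def, single_mul_single, Quiver.Path.comp_nil]
  · intro c _ hc
    rw [← mul_def, single_mul_single_of_ne _ _ hc.symm]
  · simp

theorem single_mul_one {a b : V} (p : Quiver.Path a b) :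
    (mulHom (single p) 1 : PathAlgebra k V) = single p := by
  rw [one_def, map_sum, Finset.sum_eq_single a]
  · rw [← mul_def, single_mul_single, Quiver.Path.nil_comp]
  · intro c _ hc
    rw [← mul_def, single_mul_single_of_ne _ _ hc]
  · simp

noncomputable instance : Ring (PathAlgebra k V) :=
  { (inferInstance : AddCommGroup (PathAlgebra k V)),
    (inferInstance : Mul (PathAlgebra k V)), (inferInstance : One (PathAlgebra k V)) with
    left_distrib := fun x y z => by simp [mul_def]
    right_distrib := fun x y z => by simp [mul_def]
    zero_mul := fun x => by simp [mul_def]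
    mul_zero := fun x => by simp [mul_def]
    one_mul := fun x => by
      have h : mulHom (1 : PathAlgebra k V) = LinearMap.id :=
        hom_ext fun a b p => one_mul_single p
      rw [mul_def, h, LinearMap.id_apply]
    mul_one := fun x => by
      have h : mulHom.flip (1 : PathAlgebra k V) = LinearMap.id :=
        hom_ext fun a b p => single_mul_one p
      exact LinearMap.congr_fun h x
    mul_assoc := fun x y z => by
      simp only [mul_def]
      induction x using induction_linear with
      | zero => simp
      | add x x' hx hx' => simp [hx, hx']
      | smul r x hx => simp [hx]
      | single p =>
        induction y using induction_linear with
        | zero => simp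
        | add y y' hy hy' => simp [hy, hy']
        | smul r y hy => simp [hy]
        | single q =>
          induction z using induction_linear with
          | zero => simp
          | add z z' hz hz' => simp [hz, hz']
          | smul r z hz => simp [hz]
          | single t => exact single_mul_assoc p q t }

noncomputable instance : Algebra k (PathAlgebra k V) :=
  Algebra.ofModule (fun r x y => by simp [mul_def]) (fun r x y => by simp [mul_def])

end PathAlgebra

end PathAlgebra

/-! ### Finiteness of path algebras of finite acyclic quivers -/

section Finiteness

/-- If the vertices of a finite quiver can be ranked so that every arrow raises the rank, then
there are only finitely many paths between any two vertices. -/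
theorem QuiverPath.finite_path {V : Type v} [Quiver.{w} V] [Finite V]
    [∀ a b : V, Finite (a ⟶ b)] (rk : V → ℕ) (hrk : ∀ (a b : V), (a ⟶ b) → rk a < rk b) (a : V) :
    ∀ (n : ℕ) (b : V), rk b < n → Finite (Quiver.Path a b) := by
  intro n
  induction n with
  | zero => intro b hb; omega
  | succ n ih =>
    intro b hb
    have hfin : Finite (Σ c : {c : V // rk c < rk b}, Quiver.Path a c.1 × (c.1 ⟶ b)) := by
      have : ∀ c : {c : V // rk c < rk b}, Finite (Quiver.Path a c.1) := fun c =>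
        ih c.1 (by have := c.2; omega)
      infer_instance
    let f : Quiver.Path a b →
        Option (Σ c : {c : V // rk c < rk b}, Quiver.Path a c.1 × (c.1 ⟶ b)) := fun p =>
      match p with
      | .nil => none
      | .cons (b := c) q e => some ⟨⟨c, hrk _ _ e⟩, q, e⟩
    refine Finite.of_injective f ?_
    intro p q hpq
    cases p with
    | nil =>
      cases q with
      | nil => rfl
      | cons q e => exact absurd hpq (by simp [f])
    | cons p e =>
      cases q with
      | nil => exact absurd hpq (by simp [f])
      | cons q e' =>
        simp only [f, Option.some.injEq, Sigma.mk.injEq, Subtype.mk.injEq] at hpq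
        obtain ⟨h, hpq⟩ := hpq
        subst h
        simp only [heq_eq_eq, Prod.mk.injEq] at hpq
        rw [hpq.1, hpq.2]

theorem PathAlgebra.finite (k : Type u) [Field k] {V : Type v} [Quiver.{w} V] [Finite V]
    [∀ a b : V, Finite (a ⟶ b)] (rk : V → ℕ) (hrk : ∀ (a b : V), (a ⟶ b) → rk a < rk b) :
    Module.Finite k (PathAlgebra k V) := by
  have : ∀ a b : V, Finite (Quiver.Path a b) := fun a b =>
    QuiverPath.finite_path rk hrk a (rk b + 1) b (Nat.lt_succ_self _)
  have : Finite (QuiverPath V) := by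
    refine Finite.of_injective
      (fun p : QuiverPath V => (⟨p.source, p.target, p.path⟩ : Σ a b : V, Quiver.Path a b)) ?_
    rintro ⟨a, b, p⟩ ⟨a', b', p'⟩ h
    simp only [Sigma.mk.injEq] at h
    obtain ⟨rfl, h⟩ := h
    simp only [heq_eq_eq, Sigma.mk.injEq] at h
    obtain ⟨rfl, h⟩ := h
    rw [eq_of_heq h]
  exact inferInstanceAs (Module.Finite k (QuiverPath V →₀ k))

/-- A quotient of a finite-dimensional algebra by a two-sided ideal is (left) Noetherian. -/
theorem isNoetherianRing_ringQuot (k : Type u) [Field k] {A : Type v} [Ring A] [Algebra k A]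
    [Module.Finite k A] (r : A → A → Prop) : IsNoetherianRing (RingQuot r) := by
  have : Module.Finite k (RingQuot r) :=
    Module.Finite.of_surjective (RingQuot.mkAlgHom k r).toLinearMap
      (RingQuot.mkAlgHom_surjective k r)
  exact IsNoetherianRing.of_finite k (RingQuot r)

end Finiteness

/-! ### The algebras `T` and `S` -/

section TubularAlgebra

/-- The vertices of the quiver of the tubular canonical algebras of type `(2, 2, 2, 2)`. -/
inductive TubularVertex : Type
  | top
  | mid (i : Fin 4)
  | bot
  deriving DecidableEq, Fintype

/-- The arrows: `a i : top ⟶ mid i` and `b i : mid i ⟶ bot`. -/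
inductive TubularArrow : TubularVertex → TubularVertex → Type
  | a (i : Fin 4) : TubularArrow .top (.mid i)
  | b (i : Fin 4) : TubularArrow (.mid i) .bot

instance : Quiver TubularVertex := ⟨TubularArrow⟩

/-- The path `b i a i` of length two through the `i`-th middle vertex: first `a i`, then `b i`. -/
noncomputable def tubularPath (k : Type u) [Field k] (i : Fin 4) : PathAlgebra k TubularVertex :=
  PathAlgebra.single (Quiver.Hom.toPath (TubularArrow.b i : TubularVertex.mid i ⟶ .bot)) *
    PathAlgebra.single (Quiver.Hom.toPath (TubularArrow.a i : TubularVertex.top ⟶ .mid i))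

/-- The relations `b₁ a₁ - b₂ a₂ = b₃ a₃` and `b₁ a₁ - lam b₂ a₂ = b₄ a₄` (the four middle vertices
being numbered `0, 1, 2, 3`). -/
inductive TubularRel (k : Type u) [Field k] (lam : k) :
    PathAlgebra k TubularVertex → PathAlgebra k TubularVertex → Prop
  | rel₁ : TubularRel k lam (tubularPath k 0 - tubularPath k 1) (tubularPath k 2)
  | rel₂ : TubularRel k lam (tubularPath k 0 - lam • tubularPath k 1) (tubularPath k 3)

/-- The algebra `T_lam`: the path algebra modulo the two-sided ideal generated by the relations. -/
abbrev TubularAlgebra (k : Type u) [Field k] (lam : k) : Type u :=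
  RingQuot (TubularRel k lam)

/-- The degenerate tubular algebra `T = T_0`. -/
abbrev DegenerateTubularAlgebra (k : Type u) [Field k] : Type u :=
  TubularAlgebra k 0

instance (a b : TubularVertex) : Finite (a ⟶ b) := by
  refine Finite.of_injective (β := Fin 2 × Fin 4)
    (fun e => match e with
      | TubularArrow.a i => (0, i)
      | TubularArrow.b i => (1, i)) ?_
  intro e e' h
  change TubularArrow a b at e e'
  cases e <;> cases e' <;> rfl

instance (k : Type u) [Field k] : Module.Finite k (PathAlgebra k TubularVertex) :=
  PathAlgebra.finite k
    (fun x => match x with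
      | .top => 0
      | .mid _ => 1
      | .bot => 2)
    (by intro a b e; change TubularArrow a b at e; cases e <;> simp)

instance (k : Type u) [Field k] (lam : k) : IsNoetherianRing (TubularAlgebra k lam) :=
  isNoetherianRing_ringQuot k _

end TubularAlgebra

section SphereAlgebra

/-- The six vertices of the quiver of `S`: two sources, two middle vertices, two sinks. -/
inductive SphereVertex : Type
  | srcP
  | srcM
  | midP
  | midM
  | snkP
  | snkM
  deriving DecidableEq

instance : Fintype SphereVertex :=
  ⟨{.srcP, .srcM, .midP, .midM, .snkP, .snkM}, by intro x; cases x <;> decide⟩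

/-- The eight arrows of the quiver of `S`; `P` and `M` stand for the indices `+` and `-`. -/
inductive SphereArrow : SphereVertex → SphereVertex → Type
  | aP : SphereArrow .srcP .midP
  | aM : SphereArrow .srcM .midM
  | cP : SphereArrow .srcP .midM
  | cM : SphereArrow .srcM .midP
  | bP : SphereArrow .midP .snkP
  | bM : SphereArrow .midM .snkM
  | dP : SphereArrow .midP .snkM
  | dM : SphereArrow .midM .snkP

instance : Quiver SphereVertex := ⟨SphereArrow⟩

/-- The element of the path algebra given by an arrow. -/
noncomputable def sphereArrow (k : Type u) [Field k] {x y : SphereVertex} (e : SphereArrow x y) :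
    PathAlgebra k SphereVertex :=
  PathAlgebra.single (Quiver.Hom.toPath (e : x ⟶ y))

open SphereArrow in
/-- The relations: any two parallel paths of length two are equal. -/
inductive SphereRel (k : Type u) [Field k] :
    PathAlgebra k SphereVertex → PathAlgebra k SphereVertex → Prop
  | rel₁ : SphereRel k (sphereArrow k dP * sphereArrow k aP) (sphereArrow k bM * sphereArrow k cP)
  | rel₂ : SphereRel k (sphereArrow k dM * sphereArrow k aM) (sphereArrow k bP * sphereArrow k cM)
  | rel₃ : SphereRel k (sphereArrow k bP * sphereArrow k aP) (sphereArrow k dM * sphereArrow k cP)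
  | rel₄ : SphereRel k (sphereArrow k bM * sphereArrow k aM) (sphereArrow k dP * sphereArrow k cM)

/-- The algebra `S`: the path algebra modulo the two-sided ideal generated by the relations. -/
abbrev SphereAlgebra (k : Type u) [Field k] : Type u :=
  RingQuot (SphereRel k)

instance (a b : SphereVertex) : Finite (a ⟶ b) := by
  have : Subsingleton (a ⟶ b) := ⟨fun e e' => by
    change SphereArrow a b at e e'
    cases e <;> cases e' <;> rfl⟩
  infer_instance

instance (k : Type u) [Field k] : Module.Finite k (PathAlgebra k SphereVertex) :=
  PathAlgebra.finite k
    (fun x => match x with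
      | .srcP => 0
      | .srcM => 0
      | .midP => 1
      | .midM => 1
      | .snkP => 2
      | .snkM => 2)
    (by intro a b e; change SphereArrow a b at e; cases e <;> decide)

instance (k : Type u) [Field k] : IsNoetherianRing (SphereAlgebra k) :=
  isNoetherianRing_ringQuot k _

end SphereAlgebra

/-! ### Derived equivalence -/

section DerivedEquivalence

variable (A : Type u) [Ring A] [IsNoetherianRing A]

instance : (ModuleCat.isFG.{v} A).IsClosedUnderSubobjects where
  prop_of_mono {X Y} f _ hY := by
    have : Module.Finite A Y := hY
    exact Module.Finite.of_injective f.hom ((ModuleCat.mono_iff_injective f).1 inferInstance)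

instance : (ModuleCat.isFG.{v} A).IsClosedUnderQuotients where
  prop_of_epi {X Y} f _ hX := by
    have : Module.Finite A X := hX
    exact Module.Finite.of_surjective f.hom ((ModuleCat.epi_iff_surjective f).1 inferInstance)

instance : (ModuleCat.isFG.{v} A).ContainsZero where
  exists_zero := ⟨ModuleCat.of A PUnit, ModuleCat.isZero_of_subsingleton _,
    inferInstanceAs (Module.Finite A PUnit.{v + 1})⟩

instance : (ModuleCat.isFG.{v} A).IsClosedUnderFiniteProducts where
  isClosedUnderLimitsOfShape J _ := ⟨by
    rintro X ⟨h⟩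
    have : ∀ j : J, Module.Finite A (h.diag.obj ⟨j⟩) := fun j => h.prop_diag_obj ⟨j⟩
    refine Module.Finite.of_injective
      (LinearMap.pi fun j : J => (h.π.app ⟨j⟩).hom : X →ₗ[A] ∀ j : J, h.diag.obj ⟨j⟩) ?_
    intro x y hxy
    refine Limits.Concrete.isLimit_ext _ h.isLimit x y ?_
    rintro ⟨j⟩
    exact congrFun hxy j⟩

/-- The category of finitely generated left modules over a left Noetherian ring is abelian. -/
noncomputable instance : Abelian (FGModuleCat.{v} A) :=
  inferInstanceAs (Abelian (ModuleCat.isFG.{v} A).FullSubcategory)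

noncomputable instance : HasDerivedCategory (FGModuleCat.{v} A) :=
  HasDerivedCategory.standard _

/-- The bounded derived category `D^b(A-mod)` of the category of finitely generated left modules
over a left Noetherian ring `A`. -/
abbrev BoundedDerivedCategory : Type (u + 1) :=
  DerivedCategory.Bounded (FGModuleCat.{u} A)

/-- Two left Noetherian rings are derived equivalent if the bounded derived categories of their
finitely generated left modules are equivalent as triangulated categories. -/
def DerivedEquivalent (B : Type u) [Ring B] [IsNoetherianRing B] : Prop :=
  ∃ (e : BoundedDerivedCategory A ≌ BoundedDerivedCategory B) (_ : e.functor.CommShift ℤ),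
    e.functor.IsTriangulated

end DerivedEquivalence

/-!
Both algebras are path algebras of finite acyclic quivers modulo relations, so finitely generated
modules over them are finite-dimensional representations of these quivers satisfying the relations
(`PathAlgebra.repEquivalence`). It remains to compare the two categories of representations. With
the middle vertices of the quiver of `T` numbered `0, 1, 2, 3`, the relations read
`b₀a₀ = b₁a₁ + b₂a₂ = b₃a₃`.

Each of the two quivers is cut into a cospan (`1₊ ⟶ 2₊ ⟵ 1₋` in `S`, `m₁ ⟶ bot ⟵ m₂` in `T`) and a
fork (`3₊ ⟵ 2₋ ⟶ 3₋` in `S`, `m₀ ⟵ top ⟶ m₃` in `T`). In `S` the arrows between the two parts lead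
from the cospan to the fork. In `T` they lead from the fork to the cospan. The derived equivalence
exchanges these two ways of gluing. There are exact functors `M₀, M₁` from representations of `S` to
those of `T` and `N₀, N₁` in the opposite direction; those with index `0` for `M` and `1` for `N`
depend only on the cospan (`cospanTubular`, `cospanSphere`), the other two only on the fork
(`forkTubular`, `forkSphere`). The connecting arrows and the relations of `S` amount to a natural
transformation `δ : M₀ ⟶ M₁`, those of `T` to `ε : N₀ ⟶ N₁`.

The cone of a transformation of exact functors, taken on complexes, preserves quasi-isomorphisms,
shifts and degreewise split sequences, and hence induces a triangulated functor of derived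
categories (`CategoryTheory.NatTrans.coneDerived`). The composite of the cones of `δ` and `ε` is the
total complex of the square of composites `NᵢMⱼ`. In this square `N₁M₁ = 0`, and the other three
corners form a bicartesian square together with the identity functor. So
`0 ⟶ N₀M₀ ⟶ N₀M₁ ⊕ N₁M₀ ⟶ 𝟭 ⟶ 0` is exact, and the composite of the cones is the shift by one. In
the opposite order, `M₀N₀ = 0`, and `0 ⟶ 𝟭 ⟶ M₀N₁ ⊕ M₁N₀ ⟶ M₁N₁ ⟶ 0` is exact, with the same
conclusion. This is `CategoryTheory.NatTrans.boundedEquivalent_of_bicartesianSq`. That the squares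
are bicartesian is checked at each vertex, where two parallel sides are bijective
(`bicartesianSq_sphere`, `bicartesianSq_tubular`).
-/

section

open Limits HomologicalComplex Pretriangulated

/-! ### Components of shifted complexes -/

namespace CochainComplex

variable {A : Type*} [Category* A] [Preadditive A]

/-- The identification of the degree `i` part of `K⟦n⟧` with the degree `i + n` part of `K`. It is
the identity, but naming it keeps the two expressions for this object apart, so that rewriting does
not depend on unfolding the shift functor. -/
def shiftX (K : CochainComplex A ℤ) (n i : ℤ) : (K⟦n⟧).X i ≅ K.X (i + n) := Iso.refl _

lemma shiftX_naturality {K L : CochainComplex A ℤ} (f : K ⟶ L) (n i : ℤ) :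
    (f⟦n⟧').f i ≫ (L.shiftX n i).hom = (K.shiftX n i).hom ≫ f.f (i + n) :=
  (Category.comp_id _).trans (Category.id_comp _).symm

lemma shiftX_naturality_assoc {K L : CochainComplex A ℤ} (f : K ⟶ L) (n i : ℤ) {Z : A} (φ : _ ⟶ Z) :
    (f⟦n⟧').f i ≫ (L.shiftX n i).hom ≫ φ = (K.shiftX n i).hom ≫ f.f (i + n) ≫ φ := by
  simpa only [Category.assoc, Category.id_comp, zero_comp] using shiftX_naturality f n i =≫ φ

lemma shiftX_inv_naturality {K L : CochainComplex A ℤ} (f : K ⟶ L) (n i : ℤ) :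
    (K.shiftX n i).inv ≫ (f⟦n⟧').f i = f.f (i + n) ≫ (L.shiftX n i).inv :=
  (Category.id_comp _).trans (Category.comp_id _).symm

lemma d_shiftX (K : CochainComplex A ℤ) (n i j : ℤ) :
    (K⟦n⟧).d i j ≫ (K.shiftX n j).hom =
      n.negOnePow • ((K.shiftX n i).hom ≫ K.d (i + n) (j + n)) :=
  (Category.comp_id _).trans (congrArg (n.negOnePow • ·) (Category.id_comp _).symm)

lemma d_shiftX_assoc (K : CochainComplex A ℤ) (n i j : ℤ) {Z : A} (φ : _ ⟶ Z) :
    (K⟦n⟧).d i j ≫ (K.shiftX n j).hom ≫ φ =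
      (n.negOnePow • ((K.shiftX n i).hom ≫ K.d (i + n) (j + n))) ≫ φ := by
  simpa only [Category.assoc, Category.id_comp, zero_comp] using d_shiftX K n i j =≫ φ

lemma shiftX_inv_d (K : CochainComplex A ℤ) (n i j : ℤ) :
    (K.shiftX n i).inv ≫ (K⟦n⟧).d i j =
      n.negOnePow • (K.d (i + n) (j + n) ≫ (K.shiftX n j).inv) :=
  (Category.id_comp _).trans (congrArg (n.negOnePow • ·) (Category.comp_id _).symm)

lemma shiftFunctorZero_hom_app_f_shiftX (K : CochainComplex A ℤ) (i : ℤ) :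
    ((shiftFunctorZero (CochainComplex A ℤ) ℤ).hom.app K).f i =
      (K.shiftX 0 i).hom ≫ (K.XIsoOfEq (add_zero i)).hom :=
  (shiftFunctorZero_hom_app_f K i).trans (Category.id_comp _).symm

lemma shiftFunctorZero_inv_app_f_shiftX (K : CochainComplex A ℤ) (i : ℤ) :
    ((shiftFunctorZero (CochainComplex A ℤ) ℤ).inv.app K).f i =
      (K.XIsoOfEq (add_zero i).symm).hom ≫ (K.shiftX 0 i).inv :=
  (shiftFunctorZero_inv_app_f K i).trans (Category.comp_id _).symm

lemma shiftFunctorAdd_hom_app_f_shiftX (K : CochainComplex A ℤ) (a b i : ℤ) :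
    ((shiftFunctorAdd (CochainComplex A ℤ) a b).hom.app K).f i =
      (K.shiftX (a + b) i).hom ≫ (K.XIsoOfEq (by lia)).hom ≫
        (K.shiftX a (i + b)).inv ≫ ((K⟦a⟧).shiftX b i).inv :=
  (shiftFunctorAdd_hom_app_f K a b i).trans
    ((Category.id_comp _).trans
      ((congrArg (_ ≫ ·) (Category.comp_id _)).trans (Category.comp_id _))).symm

lemma shiftFunctorAdd_inv_app_f_shiftX (K : CochainComplex A ℤ) (a b i : ℤ) :
    ((shiftFunctorAdd (CochainComplex A ℤ) a b).inv.app K).f i =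
      ((K⟦a⟧).shiftX b i).hom ≫ (K.shiftX a (i + b)).hom ≫
        (K.XIsoOfEq (by lia)).hom ≫ (K.shiftX (a + b) i).inv :=
  (shiftFunctorAdd_inv_app_f K a b i).trans
    ((Category.id_comp _).trans
      ((Category.id_comp _).trans (Category.comp_id _))).symm

end CochainComplex

/-! ### The cone of a natural transformation on complexes -/

namespace CategoryTheory.NatTrans

variable {A B : Type*} [Category* A] [Category* B] [Preadditive A] [Preadditive B]
  [HasBinaryBiproducts B] {M₀ M₁ : A ⥤ B} [M₀.Additive] [M₁.Additive] (δ : M₀ ⟶ M₁)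

/-- The matrix `(x, y) ↦ (d x, (-1)^i δ x + d y)` of the differential of the cone of `δ`. The sign
is put on `δ`, and not on the differential of the `M₀`-part as for the mapping cone: then the cone
commutes with shifts by a map that is the identity on both summands. -/
noncomputable def coneD (K : CochainComplex A ℤ) (i j : ℤ) :
    M₀.obj (K.X (i + 1)) ⊞ M₁.obj (K.X i) ⟶ M₀.obj (K.X (j + 1)) ⊞ M₁.obj (K.X j) :=
  biprod.map (M₀.map (K.d (i + 1) (j + 1))) (M₁.map (K.d i j)) +
    if h : i + 1 = j then
      i.negOnePow • (biprod.fst ≫ δ.app _ ≫ M₁.map (K.XIsoOfEq h).hom ≫ biprod.inr) else 0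

/-- The cone of `δ : M₀ ⟶ M₁` at a complex `K`: the total complex of
`M₀.map K ⟶ M₁.map K`, with `M₁.obj (K.X i)` and `M₀.obj (K.X (i + 1))` in degree `i`. -/
noncomputable def coneObj (K : CochainComplex A ℤ) : CochainComplex B ℤ where
  X i := M₀.obj (K.X (i + 1)) ⊞ M₁.obj (K.X i)
  d i j := coneD δ K i j
  shape i j h := by
    have h' : ¬ i + 1 = j := h
    simp [coneD, h']
    ext <;> simp
  d_comp_d' := by
    rintro i _ _ rfl rfl
    ext <;> simp [coneD, Int.negOnePow_succ, ← Functor.map_comp_assoc]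

section

variable (K : CochainComplex A ℤ)

/-- The degree `i` part of the cone. -/
noncomputable def coneXIso (i : ℤ) :
    (coneObj δ K).X i ≅ M₀.obj (K.X (i + 1)) ⊞ M₁.obj (K.X i) := Iso.refl _

lemma coneObj_d (i j : ℤ) :
    (coneObj δ K).d i j = (coneXIso δ K i).hom ≫ coneD δ K i j ≫ (coneXIso δ K j).inv :=
  ((Category.id_comp _).trans (Category.comp_id _)).symm

/-- The inclusion of the `M₀`-part, as a map of graded objects of degree `-1`. As for the mapping
cone of Mathlib, the index `j = i + 1` is a free variable, to avoid casts. -/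
noncomputable def coneInl (i j : ℤ) (h : i + 1 = j) : M₀.obj (K.X j) ⟶ (coneObj δ K).X i :=
  M₀.map (K.XIsoOfEq h).inv ≫ biprod.inl ≫ (coneXIso δ K i).inv

/-- The inclusion of the `M₁`-part; it is a morphism of complexes. -/
noncomputable def coneInr (i : ℤ) : M₁.obj (K.X i) ⟶ (coneObj δ K).X i :=
  biprod.inr ≫ (coneXIso δ K i).inv

/-- The projection to the `M₀`-part; it is a morphism of complexes of degree `1`. -/
noncomputable def coneFst (i j : ℤ) (h : i + 1 = j) : (coneObj δ K).X i ⟶ M₀.obj (K.X j) :=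
  (coneXIso δ K i).hom ≫ biprod.fst ≫ M₀.map (K.XIsoOfEq h).hom

/-- The projection to the `M₁`-part, as a map of graded objects. -/
noncomputable def coneSnd (i : ℤ) : (coneObj δ K).X i ⟶ M₁.obj (K.X i) :=
  (coneXIso δ K i).hom ≫ biprod.snd

@[simp]
lemma coneInl_fst (i j : ℤ) (h : i + 1 = j) : coneInl δ K i j h ≫ coneFst δ K i j h = 𝟙 _ := by
  subst h; simp [coneInl, coneFst]

@[simp]
lemma coneInl_fst_assoc (i j : ℤ) (h : i + 1 = j) {Z : B} (φ : _ ⟶ Z) :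
    coneInl δ K i j h ≫ coneFst δ K i j h ≫ φ = φ := by
  simpa only [Category.assoc, Category.id_comp, zero_comp] using coneInl_fst δ K i j h =≫ φ

@[simp]
lemma coneInl_snd (i j : ℤ) (h : i + 1 = j) : coneInl δ K i j h ≫ coneSnd δ K i = 0 := by
  simp [coneInl, coneSnd]

@[simp]
lemma coneInl_snd_assoc (i j : ℤ) (h : i + 1 = j) {Z : B} (φ : _ ⟶ Z) :
    coneInl δ K i j h ≫ coneSnd δ K i ≫ φ = 0 := by
  simpa only [Category.assoc, Category.id_comp, zero_comp] using coneInl_snd δ K i j h =≫ φ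

@[simp]
lemma coneInr_fst (i j : ℤ) (h : i + 1 = j) : coneInr δ K i ≫ coneFst δ K i j h = 0 := by
  simp [coneInr, coneFst]

@[simp]
lemma coneInr_fst_assoc (i j : ℤ) (h : i + 1 = j) {Z : B} (φ : _ ⟶ Z) :
    coneInr δ K i ≫ coneFst δ K i j h ≫ φ = 0 := by
  simpa only [Category.assoc, Category.id_comp, zero_comp] using coneInr_fst δ K i j h =≫ φ

@[simp]
lemma coneInr_snd (i : ℤ) : coneInr δ K i ≫ coneSnd δ K i = 𝟙 _ := by
  simp [coneInr, coneSnd]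

@[simp]
lemma coneInr_snd_assoc (i : ℤ) {Z : B} (φ : _ ⟶ Z) :
    coneInr δ K i ≫ coneSnd δ K i ≫ φ = φ := by
  simpa only [Category.assoc, Category.id_comp, zero_comp] using coneInr_snd δ K i =≫ φ

lemma cone_id (i j : ℤ) (h : i + 1 = j) :
    coneFst δ K i j h ≫ coneInl δ K i j h + coneSnd δ K i ≫ coneInr δ K i = 𝟙 _ := by
  subst h
  rw [← cancel_epi (coneXIso δ K i).inv, ← cancel_mono (coneXIso δ K i).hom]
  simp [coneInl, coneInr, coneFst, coneSnd]

variable {δ K} in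
lemma cone_from_ext {i : ℤ} (j : ℤ) (h : i + 1 = j) {Y : B} {f g : (coneObj δ K).X i ⟶ Y}
    (h₀ : coneInl δ K i j h ≫ f = coneInl δ K i j h ≫ g)
    (h₁ : coneInr δ K i ≫ f = coneInr δ K i ≫ g) : f = g := by
  rw [← Category.id_comp f, ← Category.id_comp g, ← cone_id δ K i j h]
  simp [h₀, h₁]

variable {δ K} in
lemma cone_to_ext {i : ℤ} (j : ℤ) (h : i + 1 = j) {Y : B} {f g : Y ⟶ (coneObj δ K).X i}
    (h₀ : f ≫ coneFst δ K i j h = g ≫ coneFst δ K i j h)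
    (h₁ : f ≫ coneSnd δ K i = g ≫ coneSnd δ K i) : f = g := by
  rw [← Category.comp_id f, ← Category.comp_id g, ← cone_id δ K i j h]
  simp [reassoc_of% h₀, reassoc_of% h₁]

@[simp]
lemma coneInr_d (i j : ℤ) :
    coneInr δ K i ≫ (coneObj δ K).d i j = M₁.map (K.d i j) ≫ coneInr δ K j := by
  rw [coneObj_d]
  by_cases h : i + 1 = j <;> simp [coneInr, coneD, h]

@[simp]
lemma coneInr_d_assoc (i j : ℤ) {Z : B} (φ : _ ⟶ Z) :
    coneInr δ K i ≫ (coneObj δ K).d i j ≫ φ = M₁.map (K.d i j) ≫ coneInr δ K j ≫ φ := by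
  simpa only [Category.assoc, Category.id_comp, zero_comp] using coneInr_d δ K i j =≫ φ

@[simp]
lemma coneInl_d (i j l : ℤ) (h : i + 1 = j) (h' : j + 1 = l) :
    coneInl δ K i j h ≫ (coneObj δ K).d i j =
      M₀.map (K.d j l) ≫ coneInl δ K j l h' + i.negOnePow • (δ.app (K.X j) ≫ coneInr δ K j) := by
  subst h h'
  simp [coneObj_d, coneInl, coneInr, coneD, Linear.comp_units_smul]

@[simp]
lemma coneInl_d_assoc (i j l : ℤ) (h : i + 1 = j) (h' : j + 1 = l) {Z : B} (φ : _ ⟶ Z) :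
    coneInl δ K i j h ≫ (coneObj δ K).d i j ≫ φ =
      (M₀.map (K.d j l) ≫ coneInl δ K j l h' +
        i.negOnePow • (δ.app (K.X j) ≫ coneInr δ K j)) ≫ φ := by
  simpa only [Category.assoc, Category.id_comp, zero_comp] using coneInl_d δ K i j l h h' =≫ φ

@[simp]
lemma d_coneFst (i j l : ℤ) (h : i + 1 = j) (h' : j + 1 = l) :
    (coneObj δ K).d i j ≫ coneFst δ K j l h' = coneFst δ K i j h ≫ M₀.map (K.d j l) := by
  apply cone_from_ext j h <;> simp [coneInl_d_assoc _ _ _ _ _ h h']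

@[simp]
lemma d_coneFst_assoc (i j l : ℤ) (h : i + 1 = j) (h' : j + 1 = l) {Z : B} (φ : _ ⟶ Z) :
    (coneObj δ K).d i j ≫ coneFst δ K j l h' ≫ φ = coneFst δ K i j h ≫ M₀.map (K.d j l) ≫ φ := by
  simpa only [Category.assoc, Category.id_comp, zero_comp] using d_coneFst δ K i j l h h' =≫ φ

@[simp]
lemma d_coneSnd (i j : ℤ) (h : i + 1 = j) :
    (coneObj δ K).d i j ≫ coneSnd δ K j =
      coneSnd δ K i ≫ M₁.map (K.d i j) + i.negOnePow • (coneFst δ K i j h ≫ δ.app (K.X j)) := by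
  apply cone_from_ext j h <;> simp [coneInl_d_assoc _ _ _ _ _ h rfl]

@[simp]
lemma d_coneSnd_assoc (i j : ℤ) (h : i + 1 = j) {Z : B} (φ : _ ⟶ Z) :
    (coneObj δ K).d i j ≫ coneSnd δ K j ≫ φ =
      (coneSnd δ K i ≫ M₁.map (K.d i j) +
        i.negOnePow • (coneFst δ K i j h ≫ δ.app (K.X j))) ≫ φ := by
  simpa only [Category.assoc, Category.id_comp, zero_comp] using d_coneSnd δ K i j h =≫ φ

lemma coneInl_XIsoOfEq (i j i' j' : ℤ) (h : i + 1 = j) (h' : i' + 1 = j') (hi : i = i') :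
    coneInl δ K i j h ≫ ((coneObj δ K).XIsoOfEq hi).hom =
      M₀.map (K.XIsoOfEq (by lia)).hom ≫ coneInl δ K i' j' h' := by
  subst h h' hi; simp

lemma coneInl_XIsoOfEq_assoc (i j i' j' : ℤ) (h : i + 1 = j) (h' : i' + 1 = j') (hi : i = i')
    {Z : B} (φ : _ ⟶ Z) :
    coneInl δ K i j h ≫ ((coneObj δ K).XIsoOfEq hi).hom ≫ φ =
      M₀.map (K.XIsoOfEq (by lia)).hom ≫ coneInl δ K i' j' h' ≫ φ := by
  simpa only [Category.assoc, Category.id_comp, zero_comp] using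
    coneInl_XIsoOfEq δ K i j i' j' h h' hi =≫ φ

lemma coneInr_XIsoOfEq (i i' : ℤ) (hi : i = i') :
    coneInr δ K i ≫ ((coneObj δ K).XIsoOfEq hi).hom =
      M₁.map (K.XIsoOfEq hi).hom ≫ coneInr δ K i' := by
  subst hi; simp

lemma coneInr_XIsoOfEq_assoc (i i' : ℤ) (hi : i = i') {Z : B} (φ : _ ⟶ Z) :
    coneInr δ K i ≫ ((coneObj δ K).XIsoOfEq hi).hom ≫ φ =
      M₁.map (K.XIsoOfEq hi).hom ≫ coneInr δ K i' ≫ φ := by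
  simpa only [Category.assoc, Category.id_comp, zero_comp] using coneInr_XIsoOfEq δ K i i' hi =≫ φ

end

/-- The functoriality of the cone of `δ` in the complex. -/
noncomputable def coneMap {K L : CochainComplex A ℤ} (f : K ⟶ L) :
    coneObj δ K ⟶ coneObj δ L where
  f i := coneFst δ K i _ rfl ≫ M₀.map (f.f (i + 1)) ≫ coneInl δ L i _ rfl +
    coneSnd δ K i ≫ M₁.map (f.f i) ≫ coneInr δ L i
  comm' := by
    rintro i _ rfl
    apply cone_from_ext _ rfl <;> apply cone_to_ext _ rfl <;>
    simp [← Functor.map_comp]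

section

variable {K L : CochainComplex A ℤ} (f : K ⟶ L)

@[simp]
lemma coneInl_map (i j : ℤ) (h : i + 1 = j) :
    coneInl δ K i j h ≫ (coneMap δ f).f i = M₀.map (f.f j) ≫ coneInl δ L i j h := by
  subst h; simp [coneMap]

@[simp]
lemma coneInl_map_assoc (i j : ℤ) (h : i + 1 = j) {Z : B} (φ : _ ⟶ Z) :
    coneInl δ K i j h ≫ (coneMap δ f).f i ≫ φ = M₀.map (f.f j) ≫ coneInl δ L i j h ≫ φ := by
  simpa only [Category.assoc, Category.id_comp, zero_comp] using coneInl_map δ f i j h =≫ φ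

@[simp]
lemma coneInr_map (i : ℤ) :
    coneInr δ K i ≫ (coneMap δ f).f i = M₁.map (f.f i) ≫ coneInr δ L i := by
  simp [coneMap]

@[simp]
lemma coneInr_map_assoc (i : ℤ) {Z : B} (φ : _ ⟶ Z) :
    coneInr δ K i ≫ (coneMap δ f).f i ≫ φ = M₁.map (f.f i) ≫ coneInr δ L i ≫ φ := by
  simpa only [Category.assoc, Category.id_comp, zero_comp] using coneInr_map δ f i =≫ φ

@[simp]
lemma coneMap_fst (i j : ℤ) (h : i + 1 = j) :
    (coneMap δ f).f i ≫ coneFst δ L i j h = coneFst δ K i j h ≫ M₀.map (f.f j) := by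
  subst h; simp [coneMap]

@[simp]
lemma coneMap_fst_assoc (i j : ℤ) (h : i + 1 = j) {Z : B} (φ : _ ⟶ Z) :
    (coneMap δ f).f i ≫ coneFst δ L i j h ≫ φ = coneFst δ K i j h ≫ M₀.map (f.f j) ≫ φ := by
  simpa only [Category.assoc, Category.id_comp, zero_comp] using coneMap_fst δ f i j h =≫ φ

@[simp]
lemma coneMap_snd (i : ℤ) :
    (coneMap δ f).f i ≫ coneSnd δ L i = coneSnd δ K i ≫ M₁.map (f.f i) := by
  simp [coneMap]

@[simp]
lemma coneMap_snd_assoc (i : ℤ) {Z : B} (φ : _ ⟶ Z) :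
    (coneMap δ f).f i ≫ coneSnd δ L i ≫ φ = coneSnd δ K i ≫ M₁.map (f.f i) ≫ φ := by
  simpa only [Category.assoc, Category.id_comp, zero_comp] using coneMap_snd δ f i =≫ φ

end

/-- The cone of `δ`, as a functor on cochain complexes. -/
@[simps]
noncomputable def coneFunctor : CochainComplex A ℤ ⥤ CochainComplex B ℤ where
  obj K := coneObj δ K
  map f := coneMap δ f
  map_id K := by ext i; apply cone_from_ext _ rfl <;> simp
  map_comp f g := by ext i; apply cone_from_ext _ rfl <;> simp

instance : (coneFunctor δ).Additive where
  map_add := by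
    intro K L f g; ext i
    change (coneMap δ (f + g)).f i = (coneMap δ f).f i + (coneMap δ g).f i
    apply cone_from_ext _ rfl <;> simp [Functor.map_add]

-- These simp lemmas would unfold the components of shifted complexes and thereby defeat `shiftX`.
attribute [-simp] CochainComplex.shiftFunctor_obj_X' CochainComplex.shiftFunctor_map_f'
  CochainComplex.shiftFunctor_obj_d'

/-- The comparison map from the cone of a shift to the shift of the cone, in a single degree. -/
noncomputable def coneShiftHom (K : CochainComplex A ℤ) (n i : ℤ) :
    (coneObj δ (K⟦n⟧)).X i ⟶ ((coneObj δ K)⟦n⟧).X i :=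
  coneFst δ (K⟦n⟧) i (i + 1) rfl ≫ M₀.map (K.shiftX n (i + 1)).hom ≫
      coneInl δ K (i + n) (i + 1 + n) (by lia) ≫ ((coneObj δ K).shiftX n i).inv +
    coneSnd δ (K⟦n⟧) i ≫ M₁.map (K.shiftX n i).hom ≫
      coneInr δ K (i + n) ≫ ((coneObj δ K).shiftX n i).inv

/-- The comparison map from the shift of the cone to the cone of the shift, in a single degree. -/
noncomputable def coneShiftInv (K : CochainComplex A ℤ) (n i : ℤ) :
    ((coneObj δ K)⟦n⟧).X i ⟶ (coneObj δ (K⟦n⟧)).X i :=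
  ((coneObj δ K).shiftX n i).hom ≫ (coneFst δ K (i + n) (i + 1 + n) (by lia) ≫
        M₀.map (K.shiftX n (i + 1)).inv ≫ coneInl δ (K⟦n⟧) i (i + 1) rfl +
      coneSnd δ K (i + n) ≫ M₁.map (K.shiftX n i).inv ≫ coneInr δ (K⟦n⟧) i)

lemma coneInl_shiftX_hom (K : CochainComplex A ℤ) (n i j j' : ℤ) (h : i + 1 = j)
    (h' : i + n + 1 = j') :
    coneInl δ (K⟦n⟧) i j h ≫ coneShiftHom δ K n i =
      M₀.map ((K.shiftX n j).hom ≫ (K.XIsoOfEq (by lia)).hom) ≫ coneInl δ K (i + n) j' h' ≫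
        ((coneObj δ K).shiftX n i).inv := by
  subst h
  obtain rfl : j' = i + 1 + n := by lia
  rw [coneShiftHom]; simp [Preadditive.comp_add]

lemma coneInl_shiftX_hom_assoc (K : CochainComplex A ℤ) (n i j j' : ℤ) (h : i + 1 = j)
    (h' : i + n + 1 = j') {Z : B} (φ : _ ⟶ Z) :
    coneInl δ (K⟦n⟧) i j h ≫ coneShiftHom δ K n i ≫ φ =
      M₀.map ((K.shiftX n j).hom ≫ (K.XIsoOfEq (by lia)).hom) ≫ coneInl δ K (i + n) j' h' ≫
        ((coneObj δ K).shiftX n i).inv ≫ φ := by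
  simpa only [Category.assoc, Category.id_comp, zero_comp] using
    coneInl_shiftX_hom δ K n i j j' h h' =≫ φ

lemma coneInr_shiftX_hom (K : CochainComplex A ℤ) (n i : ℤ) :
    coneInr δ (K⟦n⟧) i ≫ coneShiftHom δ K n i =
      M₁.map (K.shiftX n i).hom ≫ coneInr δ K (i + n) ≫
        ((coneObj δ K).shiftX n i).inv := by
  rw [coneShiftHom]; simp [Preadditive.comp_add]

lemma coneInr_shiftX_hom_assoc (K : CochainComplex A ℤ) (n i : ℤ) {Z : B} (φ : _ ⟶ Z) :
    coneInr δ (K⟦n⟧) i ≫ coneShiftHom δ K n i ≫ φ =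
      M₁.map (K.shiftX n i).hom ≫ coneInr δ K (i + n) ≫
        ((coneObj δ K).shiftX n i).inv ≫ φ := by
  simpa only [Category.assoc, Category.id_comp, zero_comp] using coneInr_shiftX_hom δ K n i =≫ φ

/-- The comparison isomorphism between the cone of a shift and the shift of the cone, in a single
degree. -/
noncomputable def coneShiftX (K : CochainComplex A ℤ) (n i : ℤ) :
    (coneObj δ (K⟦n⟧)).X i ≅ ((coneObj δ K)⟦n⟧).X i where
  hom := coneShiftHom δ K n i
  inv := coneShiftInv δ K n i
  hom_inv_id := by
    rw [coneShiftInv]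
    apply cone_from_ext _ rfl
    · rw [coneInl_shiftX_hom_assoc δ K n i (i + 1) (i + 1 + n) rfl (by lia)]
      simp [← Functor.map_comp_assoc, -Functor.map_comp]
    · rw [coneInr_shiftX_hom_assoc]
      simp [← Functor.map_comp_assoc, -Functor.map_comp]
  inv_hom_id := by
    rw [← cancel_epi ((coneObj δ K).shiftX n i).inv, coneShiftInv, Category.assoc,
      Iso.inv_hom_id_assoc]
    apply cone_from_ext (i + 1 + n) (by lia)
    · simp only [Preadditive.add_comp, Preadditive.comp_add, Category.assoc,
        coneInl_shiftX_hom δ K n i (i + 1) (i + 1 + n) rfl (by lia)]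
      simp [← Functor.map_comp_assoc, -Functor.map_comp]
    · simp only [Preadditive.add_comp, Preadditive.comp_add, Category.assoc, coneInr_shiftX_hom]
      simp [← Functor.map_comp_assoc, -Functor.map_comp]

lemma map_d_shiftX (F : A ⥤ B) [F.Additive] (K : CochainComplex A ℤ) (n i j : ℤ) :
    F.map ((K⟦n⟧).d i j) ≫ F.map (K.shiftX n j).hom =
      n.negOnePow • (F.map (K.shiftX n i).hom ≫ F.map (K.d (i + n) (j + n))) := by
  rw [← F.map_comp, CochainComplex.d_shiftX, Functor.map_units_smul, F.map_comp]

lemma map_d_shiftX_assoc (F : A ⥤ B) [F.Additive] (K : CochainComplex A ℤ) (n i j : ℤ)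
    {Z : B} (φ : _ ⟶ Z) :
    F.map ((K⟦n⟧).d i j) ≫ F.map (K.shiftX n j).hom ≫ φ =
      (n.negOnePow • (F.map (K.shiftX n i).hom ≫ F.map (K.d (i + n) (j + n)))) ≫ φ := by
  simpa only [Category.assoc, Category.id_comp, zero_comp] using map_d_shiftX F K n i j =≫ φ

lemma coneShiftX_comm (K : CochainComplex A ℤ) (n i : ℤ) :
    coneShiftHom δ K n i ≫ ((coneObj δ K)⟦n⟧).d i (i + 1) =
        (coneObj δ (K⟦n⟧)).d i (i + 1) ≫ coneShiftHom δ K n (i + 1) := by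
  apply cone_from_ext _ rfl
  · rw [coneInl_shiftX_hom_assoc δ K n i (i + 1) (i + 1 + n) rfl (by lia),
      coneInl_d_assoc _ _ _ _ _ rfl rfl, CochainComplex.shiftX_inv_d, Linear.comp_units_smul,
      coneInl_d_assoc δ K (i + n) (i + 1 + n) (i + 1 + 1 + n) (by lia) (by lia)]
    simp only [Preadditive.add_comp, Category.assoc, Linear.units_smul_comp, coneInr_shiftX_hom,
      coneInl_shiftX_hom δ K n (i + 1) (i + 1 + 1) (i + 1 + 1 + n) rfl (by lia)]
    -- the sign of the shifted differential turns the sign of `δ` in degree `i + n` into that in `i`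
    have hs : n.negOnePow * (i + n).negOnePow = i.negOnePow := by
      rw [mul_comm, ← Int.negOnePow_add, Int.negOnePow_eq_iff]
      exact ⟨n, by lia⟩
    simp [map_d_shiftX_assoc, smul_smul, hs]
  · rw [coneInr_shiftX_hom_assoc, CochainComplex.shiftX_inv_d, coneInr_d_assoc, coneInr_shiftX_hom]
    simp [map_d_shiftX_assoc]

lemma coneShiftX_naturality {K L : CochainComplex A ℤ} (f : K ⟶ L) (n i : ℤ) :
    (coneMap δ (f⟦n⟧')).f i ≫ coneShiftHom δ L n i =
        coneShiftHom δ K n i ≫ ((coneMap δ f)⟦n⟧').f i := by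
  apply cone_from_ext _ rfl
  · rw [coneInl_shiftX_hom_assoc δ K n i (i + 1) (i + 1 + n) rfl (by lia), coneInl_map_assoc,
      coneInl_shiftX_hom δ L n i (i + 1) (i + 1 + n) rfl (by lia),
      CochainComplex.shiftX_inv_naturality, coneInl_map_assoc]
    simp [← Functor.map_comp_assoc, -Functor.map_comp, CochainComplex.shiftX_naturality]
  · rw [coneInr_shiftX_hom_assoc, coneInr_map_assoc, coneInr_shiftX_hom,
      CochainComplex.shiftX_inv_naturality, coneInr_map_assoc]
    simp [← Functor.map_comp_assoc, -Functor.map_comp, CochainComplex.shiftX_naturality]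

lemma coneShiftX_zero (K : CochainComplex A ℤ) (i : ℤ) :
    coneShiftHom δ K 0 i =
      (coneMap δ (K := K⟦(0 : ℤ)⟧) (L := K)
          ((shiftFunctorZero (CochainComplex A ℤ) ℤ).hom.app K)).f i ≫
        ((shiftFunctorZero (CochainComplex B ℤ) ℤ).inv.app (coneObj δ K)).f i := by
  apply cone_from_ext _ rfl
  · rw [coneInl_shiftX_hom δ K 0 i (i + 1) (i + 1 + 0) rfl (by lia), coneInl_map_assoc,
      CochainComplex.shiftFunctorZero_hom_app_f_shiftX,
      CochainComplex.shiftFunctorZero_inv_app_f_shiftX]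
    rw [coneInl_XIsoOfEq_assoc δ K i (i + 1) (i + 0) (i + 1 + 0) rfl (by lia)]
    simp [← Functor.map_comp_assoc, -Functor.map_comp]
  · rw [coneInr_shiftX_hom, coneInr_map_assoc,
      CochainComplex.shiftFunctorZero_hom_app_f_shiftX,
      CochainComplex.shiftFunctorZero_inv_app_f_shiftX, coneInr_XIsoOfEq_assoc]
    simp [← Functor.map_comp_assoc, -Functor.map_comp]

lemma coneShiftX_add (K : CochainComplex A ℤ) (a b i : ℤ) :
    coneShiftHom δ K (a + b) i =
      (coneMap δ (K := K⟦a + b⟧) (L := (K⟦a⟧)⟦b⟧)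
          ((shiftFunctorAdd (CochainComplex A ℤ) a b).hom.app K)).f i ≫
        coneShiftHom δ (K⟦a⟧) b i ≫ ((coneObj δ (K⟦a⟧)).shiftX b i).hom ≫
          coneShiftHom δ K a (i + b) ≫ (((coneObj δ K)⟦a⟧).shiftX b i).inv ≫
            ((shiftFunctorAdd (CochainComplex B ℤ) a b).inv.app (coneObj δ K)).f i := by
  apply cone_from_ext _ rfl
  · rw [coneInl_shiftX_hom δ K (a + b) i (i + 1) (i + 1 + (a + b)) rfl (by lia), coneInl_map_assoc,
      CochainComplex.shiftFunctorAdd_hom_app_f_shiftX,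
      CochainComplex.shiftFunctorAdd_inv_app_f_shiftX,
      coneInl_shiftX_hom_assoc δ (K⟦a⟧) b i (i + 1) (i + 1 + b) rfl (by lia)]
    simp only [Iso.inv_hom_id_assoc]
    rw [coneInl_shiftX_hom_assoc δ K a (i + b) (i + 1 + b) (i + 1 + b + a) (by lia) (by lia)]
    simp only [Iso.inv_hom_id_assoc]
    rw [coneInl_XIsoOfEq_assoc δ K _ _ (i + (a + b)) (i + 1 + (a + b)) _ (by lia)]
    simp [← Functor.map_comp_assoc, -Functor.map_comp]
  · rw [coneInr_shiftX_hom, coneInr_map_assoc,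
      CochainComplex.shiftFunctorAdd_hom_app_f_shiftX,
      CochainComplex.shiftFunctorAdd_inv_app_f_shiftX, coneInr_shiftX_hom_assoc]
    simp only [Iso.inv_hom_id_assoc]
    rw [coneInr_shiftX_hom_assoc]
    simp only [Iso.inv_hom_id_assoc]
    rw [coneInr_XIsoOfEq_assoc]
    simp [← Functor.map_comp_assoc, -Functor.map_comp]

/-- The cone of `δ` commutes with shifts. -/
noncomputable def coneShiftIso (n : ℤ) :
    shiftFunctor _ n ⋙ coneFunctor δ ≅ coneFunctor δ ⋙ shiftFunctor _ n :=
  NatIso.ofComponents (fun K => HomologicalComplex.Hom.isoOfComponents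
    (fun i => coneShiftX δ K n i)
    (by rintro i _ rfl; exact coneShiftX_comm δ K n i)) (fun f => by
      ext i; exact coneShiftX_naturality δ f n i)

noncomputable instance : (coneFunctor δ).CommShift ℤ where
  commShiftIso := coneShiftIso δ
  commShiftIso_zero := by
    ext K i : 4
    rw [Functor.CommShift.isoZero_hom_app]
    exact coneShiftX_zero δ K i
  commShiftIso_add := fun a b => by
    ext K i : 4
    rw [Functor.CommShift.isoAdd_hom_app]
    refine (coneShiftX_add δ K a b i).trans ?_
    refine congrArg (_ ≫ ·) (congrArg (_ ≫ ·) ?_)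
    exact (Category.id_comp _).trans (congrArg (_ ≫ ·) (Category.id_comp _))

end CategoryTheory.NatTrans

/-! ### Quasi-isomorphisms with acyclic kernel or cokernel -/

namespace CochainComplex

variable {A : Type*} [Category* A] [Abelian A] {K L : CochainComplex A ℤ}

/-- A degreewise epimorphism of complexes is a quasi-isomorphism if its kernel is acyclic; the
hypothesis states this acyclicity up to refinements, which avoids forming the kernel complex. -/
lemma quasiIso_of_epi (f : K ⟶ L) [∀ i, Epi (f.f i)]
    (h : ∀ (i : ℤ) ⦃T : A⦄ (x : T ⟶ K.X (i + 1)), x ≫ f.f (i + 1) = 0 →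
      x ≫ K.d (i + 1) (i + 1 + 1) = 0 →
      ∃ (T' : A) (π : T' ⟶ T) (_ : Epi π) (y : T' ⟶ K.X i), y ≫ f.f i = 0 ∧
        π ≫ x = y ≫ K.d i (i + 1)) : QuasiIso f := by
  rw [quasiIso_iff]
  intro i
  obtain ⟨i, rfl⟩ : ∃ j, i = j + 1 := ⟨i - 1, by lia⟩
  rw [quasiIsoAt_iff_isIso_homologyMap]
  have h₁ : Mono (homologyMap f (i + 1)) := by
    rw [mono_homologyMap_iff_up_to_refinements f i (i + 1) (i + 1 + 1) (by simp) (by simp)]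
    intro T x hx z hz
    obtain ⟨T₁, π₁, _, w, hw⟩ := surjective_up_to_refinements_of_epi (f.f i) z
    obtain ⟨T₂, π₂, _, y, hy, hy'⟩ := h i (π₁ ≫ x - w ≫ K.d i (i + 1))
      (by simp [hz, reassoc_of% hw]) (by simp [hx])
    exact ⟨T₂, π₂ ≫ π₁, epi_comp _ _, y + π₂ ≫ w, by simp [← hy']⟩
  have h₂ : Epi (homologyMap f (i + 1)) := by
    rw [epi_homologyMap_iff_up_to_refinements f i (i + 1) (i + 1 + 1) (by simp) (by simp)]
    intro T z hz
    obtain ⟨T₁, π₁, _, x, hx⟩ := surjective_up_to_refinements_of_epi (f.f (i + 1)) z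
    obtain ⟨T₂, π₂, _, y, hy, hy'⟩ := h (i + 1) (x ≫ K.d _ _)
      (by rw [Category.assoc, ← f.comm, ← reassoc_of% hx, hz, comp_zero]) (by simp)
    exact ⟨T₂, π₂ ≫ π₁, epi_comp _ _, π₂ ≫ x - y, by simp [hy'], 0, by simp [hx, hy]⟩
  exact isIso_of_mono_of_epi _

/-- A degreewise monomorphism of complexes is a quasi-isomorphism if its cokernel is acyclic; the
hypothesis states this acyclicity up to refinements: a chain `x` that becomes a cycle in the
cokernel (so that `d x = f z`) is, up to `f`, a boundary. -/
lemma quasiIso_of_mono (f : K ⟶ L) [∀ i, Mono (f.f i)]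
    (h : ∀ (i : ℤ) ⦃T : A⦄ (x : T ⟶ L.X (i + 1)) (z : T ⟶ K.X (i + 1 + 1)),
      x ≫ L.d (i + 1) (i + 1 + 1) = z ≫ f.f (i + 1 + 1) →
      ∃ (T' : A) (π : T' ⟶ T) (_ : Epi π) (y : T' ⟶ L.X i) (w : T' ⟶ K.X (i + 1)),
        π ≫ x = y ≫ L.d i (i + 1) + w ≫ f.f (i + 1)) : QuasiIso f := by
  rw [quasiIso_iff]
  intro i
  obtain ⟨i, rfl⟩ : ∃ j, i = j + 1 + 1 := ⟨i - 1 - 1, by lia⟩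
  rw [quasiIsoAt_iff_isIso_homologyMap]
  have h₁ : Mono (homologyMap f (i + 1 + 1)) := by
    rw [mono_homologyMap_iff_up_to_refinements f (i + 1) (i + 1 + 1) (i + 1 + 1 + 1)
      (by simp) (by simp)]
    intro T x hx z hz
    obtain ⟨T₁, π₁, _, y, w, hw⟩ := h i z x hz.symm
    refine ⟨T₁, π₁, inferInstance, w, ?_⟩
    rw [← cancel_mono (f.f (i + 1 + 1))]
    simp [hz, reassoc_of% hw]
  have h₂ : Epi (homologyMap f (i + 1 + 1)) := by
    rw [epi_homologyMap_iff_up_to_refinements f (i + 1) (i + 1 + 1) (i + 1 + 1 + 1)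
      (by simp) (by simp)]
    intro T z hz
    obtain ⟨T₁, π₁, _, y, w, hw⟩ := h (i + 1) z 0 (by simp [hz])
    refine ⟨T₁, π₁, inferInstance, w, ?_, y, by rw [hw]; exact add_comm _ _⟩
    rw [← cancel_mono (f.f _)]
    have := hw =≫ L.d _ (i + 1 + 1 + 1)
    simp [hz] at this
    simp [this]
  exact isIso_of_mono_of_epi _

end CochainComplex

/-! ### The cone of a transformation of exact functors; degreewise split sequences -/

namespace CategoryTheory.NatTrans

variable {A B : Type*} [Category* A] [Category* B]

section

variable [Abelian A] [Abelian B] {M₀ M₁ : A ⥤ B} [M₀.Additive] [M₁.Additive] (δ : M₀ ⟶ M₁)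
  [PreservesFiniteLimits M₀] [PreservesFiniteColimits M₀]
  [PreservesFiniteLimits M₁] [PreservesFiniteColimits M₁]

lemma acyclic_cone {K : CochainComplex A ℤ} (hK : K.Acyclic) : (coneObj δ K).Acyclic := by
  have key (M : A ⥤ B) [M.Additive] [PreservesFiniteLimits M] [PreservesFiniteColimits M]
      (i j k : ℤ) (hi : i + 1 = j) (hk : j + 1 = k) {T : B} (x : T ⟶ M.obj (K.X j))
      (hx : x ≫ M.map (K.d j k) = 0) :
      ∃ (T' : B) (π : T' ⟶ T) (_ : Epi π) (y : T' ⟶ M.obj (K.X i)),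
        π ≫ x = y ≫ M.map (K.d i j) :=
    (((exactAt_iff' K i j k (by simp [← hi]) (by simp [hk])).1 (hK j)).map M)
      |>.exact_up_to_refinements x hx
  intro i
  obtain ⟨i, rfl⟩ : ∃ j, i = j + 1 := ⟨i - 1, by lia⟩
  rw [exactAt_iff_exact_up_to_refinements _ i (i + 1) (i + 1 + 1) (by simp) (by simp)]
  intro T x hx
  have hx₀ := hx =≫ coneFst δ K _ _ rfl
  have hx₁ := hx =≫ coneSnd δ K _
  rw [Category.assoc, d_coneFst _ _ _ _ _ rfl] at hx₀
  rw [Category.assoc, d_coneSnd _ _ _ _ rfl] at hx₁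
  obtain ⟨T₁, π₁, _, y₀, hy₀⟩ := key M₀ (i + 1) (i + 1 + 1) (i + 1 + 1 + 1) rfl rfl
    (x ≫ coneFst δ K _ _ rfl) (by simpa using hx₀)
  obtain ⟨T₂, π₂, _, y₁, hy₁⟩ := key M₁ i (i + 1) (i + 1 + 1) rfl rfl
    (π₁ ≫ x ≫ coneSnd δ K _ - i.negOnePow • (y₀ ≫ δ.app _)) (by
      simp [Int.negOnePow_succ] at hx₁ 
      have := congrArg (π₁ ≫ ·) hx₁
      simp [reassoc_of% hy₀, Linear.comp_units_smul] at this
      simpa [sub_eq_add_neg, Linear.units_smul_comp] using this)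
  refine ⟨T₂, π₂ ≫ π₁, epi_comp _ _, π₂ ≫ y₀ ≫ coneInl δ K i _ rfl + y₁ ≫ coneInr δ K i, ?_⟩
  apply cone_to_ext _ rfl
  · simp [hy₀]
  · simp [← hy₁, Linear.comp_units_smul]

end

section

variable [Preadditive A] [Preadditive B] [HasBinaryBiproducts B]
  {M₀ M₁ : A ⥤ B} [M₀.Additive] [M₁.Additive] (δ : M₀ ⟶ M₁)
  (S : ShortComplex (CochainComplex A ℤ))
  (σ : ∀ n, (S.map (HomologicalComplex.eval A _ n)).Splitting)

attribute [-simp] CochainComplex.shiftFunctor_obj_X' CochainComplex.shiftFunctor_map_f'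
  CochainComplex.shiftFunctor_obj_d' CochainComplex.homOfDegreewiseSplit_f

variable {S} in
/-- The retraction of a degreewise splitting. -/
def splitR (n : ℤ) : S.X₂.X n ⟶ S.X₁.X n := (σ n).r

variable {S} in
/-- The section of a degreewise splitting. -/
def splitS (n : ℤ) : S.X₃.X n ⟶ S.X₂.X n := (σ n).s

lemma map_f_splitR (F : A ⥤ B) (n : ℤ) :
    F.map (S.f.f n) ≫ F.map (splitR σ n) = 𝟙 (F.obj (S.X₁.X n)) := by
  rw [← F.map_comp, ← F.map_id]; exact congrArg F.map (σ n).f_r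

lemma map_f_splitR_assoc (F : A ⥤ B) (n : ℤ) {Z : B} (φ : _ ⟶ Z) :
    F.map (S.f.f n) ≫ F.map (splitR σ n) ≫ φ = φ := by
  simpa only [Category.assoc, Category.id_comp, zero_comp] using map_f_splitR S σ F n =≫ φ

lemma map_splitS_g (F : A ⥤ B) (n : ℤ) :
    F.map (splitS σ n) ≫ F.map (S.g.f n) = 𝟙 (F.obj (S.X₃.X n)) := by
  rw [← F.map_comp, ← F.map_id]; exact congrArg F.map (σ n).s_g

lemma map_splitS_g_assoc (F : A ⥤ B) (n : ℤ) {Z : B} (φ : _ ⟶ Z) :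
    F.map (splitS σ n) ≫ F.map (S.g.f n) ≫ φ = φ := by
  simpa only [Category.assoc, Category.id_comp, zero_comp] using map_splitS_g S σ F n =≫ φ

lemma map_split_id (F : A ⥤ B) [F.Additive] (n : ℤ) :
    F.map (splitR σ n) ≫ F.map (S.f.f n) + F.map (S.g.f n) ≫ F.map (splitS σ n) =
      𝟙 (F.obj (S.X₂.X n)) := by
  rw [← F.map_comp, ← F.map_comp, ← F.map_add, ← F.map_id]; exact congrArg F.map (σ n).id

@[simp]
lemma splitS_splitR (n : ℤ) : splitS σ n ≫ splitR σ n = 0 := (σ n).s_r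

@[simp]
lemma splitS_splitR_assoc (n : ℤ) {Z : A} (φ : _ ⟶ Z) :
    splitS σ n ≫ splitR σ n ≫ φ = 0 := by
  simpa only [Category.assoc, Category.id_comp, zero_comp] using splitS_splitR S σ n =≫ φ

/-- The retraction of `coneSplitting`. -/
noncomputable def coneSplittingR (n : ℤ) : (coneObj δ S.X₂).X n ⟶ (coneObj δ S.X₁).X n :=
  coneFst δ S.X₂ n _ rfl ≫ M₀.map (splitR σ (n + 1)) ≫ coneInl δ S.X₁ n _ rfl +
    coneSnd δ S.X₂ n ≫ M₁.map (splitR σ n) ≫ coneInr δ S.X₁ n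

/-- The section of `coneSplitting`. -/
noncomputable def coneSplittingS (n : ℤ) : (coneObj δ S.X₃).X n ⟶ (coneObj δ S.X₂).X n :=
  coneFst δ S.X₃ n _ rfl ≫ M₀.map (splitS σ (n + 1)) ≫ coneInl δ S.X₂ n _ rfl +
    coneSnd δ S.X₃ n ≫ M₁.map (splitS σ n) ≫ coneInr δ S.X₂ n

/-- The cone of `δ` takes degreewise split short exact sequences to such sequences. -/
noncomputable def coneSplitting (n : ℤ) :
    ((S.map (coneFunctor δ)).map (HomologicalComplex.eval B _ n)).Splitting where
  r := coneSplittingR δ S σ n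
  s := coneSplittingS δ S σ n
  f_r := by
    change (coneMap δ S.f).f n ≫ coneSplittingR δ S σ n = 𝟙 ((coneObj δ S.X₁).X n)
    rw [coneSplittingR]
    apply cone_from_ext _ rfl
    · simp [map_f_splitR_assoc]
    · simp [map_f_splitR_assoc]
  s_g := by
    change coneSplittingS δ S σ n ≫ (coneMap δ S.g).f n = 𝟙 ((coneObj δ S.X₃).X n)
    rw [coneSplittingS]
    apply cone_from_ext _ rfl
    · simp [map_splitS_g_assoc]
    · simp [map_splitS_g_assoc]
  id := by
    change coneSplittingR δ S σ n ≫ (coneMap δ S.f).f n +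
      (coneMap δ S.g).f n ≫ coneSplittingS δ S σ n = 𝟙 ((coneObj δ S.X₂).X n)
    rw [coneSplittingR, coneSplittingS]
    apply cone_from_ext _ rfl
    · simpa using map_split_id S σ M₀ (n + 1) =≫ coneInl δ S.X₂ n (n + 1) rfl
    · simpa using map_split_id S σ M₁ n =≫ coneInr δ S.X₂ n

lemma homOfDegreewiseSplit_f_shiftX (n : ℤ) :
    (CochainComplex.homOfDegreewiseSplit S σ).f n ≫ (S.X₁.shiftX 1 n).hom =
      splitS σ n ≫ S.X₂.d n (n + 1) ≫
        splitR σ (n + 1) :=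
  (Category.comp_id _).trans (CochainComplex.homOfDegreewiseSplit_f S σ n)

lemma map_homOfDegreewiseSplit_f_shiftX (F : A ⥤ B) (n : ℤ) :
    F.map ((CochainComplex.homOfDegreewiseSplit S σ).f n) ≫ F.map (S.X₁.shiftX 1 n).hom =
      F.map (splitS σ n) ≫ F.map (S.X₂.d n (n + 1)) ≫ F.map (splitR σ (n + 1)) := by
  simp only [← F.map_comp, homOfDegreewiseSplit_f_shiftX]

lemma map_homOfDegreewiseSplit_f_shiftX_assoc (F : A ⥤ B) (n : ℤ) {Z : B} (φ : _ ⟶ Z) :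
    F.map ((CochainComplex.homOfDegreewiseSplit S σ).f n) ≫ F.map (S.X₁.shiftX 1 n).hom ≫ φ =
      F.map (splitS σ n) ≫ F.map (S.X₂.d n (n + 1)) ≫ F.map (splitR σ (n + 1)) ≫ φ := by
  simpa only [Category.assoc, Category.id_comp, zero_comp] using
    map_homOfDegreewiseSplit_f_shiftX S σ F n =≫ φ

lemma coneMap_homOfDegreewiseSplit (n : ℤ) :
    (coneMap δ (CochainComplex.homOfDegreewiseSplit S σ)).f n ≫ coneShiftHom δ S.X₁ 1 n ≫
      ((coneObj δ S.X₁).shiftX 1 n).hom =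
    coneSplittingS δ S σ n ≫ (coneObj δ S.X₂).d n (n + 1) ≫ coneSplittingR δ S σ (n + 1) := by
  rw [coneSplittingR, coneSplittingS]
  apply cone_from_ext _ rfl
  · rw [coneInl_map_assoc, coneInl_shiftX_hom_assoc δ S.X₁ 1 n (n + 1) (n + 1 + 1) rfl rfl]
    have h : M₀.map (splitS σ (n + 1)) ≫ δ.app (S.X₂.X (n + 1)) ≫
        M₁.map (splitR σ (n + 1)) = 0 := by
      rw [← δ.naturality, ← M₀.map_comp_assoc, splitS_splitR]
      simp
    simp [map_homOfDegreewiseSplit_f_shiftX_assoc, reassoc_of% h]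
  · rw [coneInr_map_assoc, coneInr_shiftX_hom_assoc]
    simp [map_homOfDegreewiseSplit_f_shiftX_assoc]

/-- The connecting morphism of a degreewise split sequence is compatible with the cone of `δ`. The
term `(-1)^i δ` of the differential contributes nothing to the connecting morphism, since
`splitS ≫ splitR = 0`. -/
lemma coneFunctor_map_homOfDegreewiseSplit :
    (coneFunctor δ).map (CochainComplex.homOfDegreewiseSplit S σ) ≫
      ((coneFunctor δ).commShiftIso (1 : ℤ)).hom.app S.X₁ =
    CochainComplex.homOfDegreewiseSplit (S.map (coneFunctor δ)) (coneSplitting δ S σ) := by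
  ext n
  refine (cancel_mono ((coneObj δ S.X₁).shiftX 1 n).hom).1 ?_
  exact (Category.assoc _ _ _).trans ((coneMap_homOfDegreewiseSplit δ S σ n).trans
    (homOfDegreewiseSplit_f_shiftX (S.map (coneFunctor δ)) (coneSplitting δ S σ) n).symm)

/-- The cone of `δ` is compatible with the triangles of degreewise split sequences. -/
noncomputable def coneTriangleIso :
    (coneFunctor δ).mapTriangle.obj (CochainComplex.triangleOfDegreewiseSplit S σ) ≅
      CochainComplex.triangleOfDegreewiseSplit (S.map (coneFunctor δ)) (coneSplitting δ S σ) :=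
  Triangle.isoMk _ _ (Iso.refl _) (Iso.refl _) (Iso.refl _)
    ((Category.comp_id _).trans (Category.id_comp _).symm)
    ((Category.comp_id _).trans (Category.id_comp _).symm)
    (by
      refine (congrArg (_ ≫ ·) (Functor.map_id _ _)).trans ((Category.comp_id _).trans ?_)
      exact (coneFunctor_map_homOfDegreewiseSplit δ S σ).trans (Category.id_comp _).symm)

end

end CategoryTheory.NatTrans

/-! ### The triangulated functor induced by the cone -/

namespace DerivedCategory

variable {A : Type*} [Category* A] [Abelian A] [HasDerivedCategory A]

lemma triangleOfDegreewiseSplit_distinguished (S : ShortComplex (CochainComplex A ℤ))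
    (σ : ∀ n, (S.map (HomologicalComplex.eval A _ n)).Splitting) :
    Q.mapTriangle.obj (CochainComplex.triangleOfDegreewiseSplit S σ) ∈
      distTriang (DerivedCategory A) :=
  isomorphic_distinguished _ (Qh.map_distinguished _
      ((HomotopyCategory.distinguished_iff_iso_trianglehOfDegreewiseSplit _).2
        ⟨S, σ, ⟨Iso.refl _⟩⟩)) _
    ((Functor.mapTriangleIso (quotientCompQhIso A)).symm.app _ ≪≫
      (Functor.mapTriangleCompIso (HomotopyCategory.quotient A _) Qh).app _)

lemma isZero_Q_obj_iff (K : CochainComplex A ℤ) : IsZero (Q.obj K) ↔ K.Acyclic := by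
  refine ⟨fun h i => ?_, fun h => ?_⟩
  · rw [exactAt_iff_isZero_homology]
    exact ((homologyFunctorFactors A i).app K).isZero_iff.1 ((homologyFunctor A i).map_isZero h)
  · have : QuasiIso (0 : K ⟶ K) := by
      rw [quasiIso_iff]
      intro i
      rw [quasiIsoAt_iff_exactAt _ _ (h i)]
      exact h i
    have := (isIso_Q_map_iff_quasiIso A (0 : K ⟶ K)).2 this
    exact (IsZero.iff_id_eq_zero _).2 ((cancel_epi (Q.map (0 : K ⟶ K))).1 (by simp [Q.map_zero]))

end DerivedCategory

namespace CategoryTheory.NatTrans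

section

variable {A B : Type*} [Category* A] [Category* B] [Preadditive A] [Preadditive B]
  [HasBinaryBiproducts B] {M₀ M₁ : A ⥤ B} [M₀.Additive] [M₁.Additive] (δ : M₀ ⟶ M₁)

lemma isZero_coneObj_X {K : CochainComplex A ℤ} {i : ℤ} (h₀ : IsZero (K.X (i + 1)))
    (h₁ : IsZero (K.X i)) : IsZero ((coneObj δ K).X i) := by
  rw [IsZero.iff_id_eq_zero]
  exact cone_from_ext _ rfl ((M₀.map_isZero h₀).eq_of_src _ _) ((M₁.map_isZero h₁).eq_of_src _ _)

end

variable {A B : Type*} [Category* A] [Category* B] [Abelian A] [Abelian B]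
  [HasDerivedCategory A] [HasDerivedCategory B]
  {M₀ M₁ : A ⥤ B} [M₀.Additive] [M₁.Additive] (δ : M₀ ⟶ M₁)

/-- A mapping cone triangle is, up to rotation, the triangle of a degreewise split sequence, and
these are preserved by the cone of `δ`. No exactness of `M₀` and `M₁` is needed. -/
lemma coneFunctor_mapTriangle_distinguished {K L : CochainComplex A ℤ} (f : K ⟶ L) :
    (coneFunctor δ ⋙ DerivedCategory.Q).mapTriangle.obj (CochainComplex.mappingCone.triangle f) ∈
      distTriang (DerivedCategory B) := by
  rw [rotate_distinguished_triangle]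
  let S := CochainComplex.mappingCone.triangleRotateShortComplex f
  let σ := CochainComplex.mappingCone.triangleRotateShortComplexSplitting f
  exact isomorphic_distinguished _
    (DerivedCategory.triangleOfDegreewiseSplit_distinguished _ (coneSplitting δ S σ)) _
    ((coneFunctor δ ⋙ DerivedCategory.Q).mapTriangleRotateIso.app _ ≪≫
      (coneFunctor δ ⋙ DerivedCategory.Q).mapTriangle.mapIso
        (CochainComplex.mappingCone.triangleRotateIsoTriangleOfDegreewiseSplit f) ≪≫
      (Functor.mapTriangleCompIso (coneFunctor δ) DerivedCategory.Q).app _ ≪≫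
      DerivedCategory.Q.mapTriangle.mapIso (coneTriangleIso δ S σ))

variable [PreservesFiniteLimits M₀] [PreservesFiniteColimits M₀]
  [PreservesFiniteLimits M₁] [PreservesFiniteColimits M₁]

/-- The mapping cone of a quasi-isomorphism is acyclic, hence so is its image under the cone of
`δ`, which is the third vertex of a distinguished triangle over `coneMap δ f`. -/
lemma quasiIso_coneMap {K L : CochainComplex A ℤ} (f : K ⟶ L) [QuasiIso f] :
    QuasiIso (coneMap δ f) := by
  have hf := (DerivedCategory.isIso_Q_map_iff_quasiIso A f).2 inferInstance
  have h₁ := Triangle.isZero₃_of_isIso₁ _ (DerivedCategory.mappingCone_triangle_distinguished f) hf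
  have h₂ := acyclic_cone δ ((DerivedCategory.isZero_Q_obj_iff _).1 h₁)
  exact (DerivedCategory.isIso_Q_map_iff_quasiIso B _).1
    ((Triangle.isZero₃_iff_isIso₁ _ (coneFunctor_mapTriangle_distinguished δ f)).1
      ((DerivedCategory.isZero_Q_obj_iff _).2 h₂))

/-- The cone of `δ`, as a morphism of localizers for the quasi-isomorphisms. -/
noncomputable def coneLocalizerMorphism :
    LocalizerMorphism (HomologicalComplex.quasiIso A (ComplexShape.up ℤ))
      (HomologicalComplex.quasiIso B (ComplexShape.up ℤ)) where
  functor := coneFunctor δ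
  map _ _ f hf := by
    have : QuasiIso f := hf
    exact quasiIso_coneMap δ f

/-- The functor induced on derived categories by the cone of a transformation `δ : M₀ ⟶ M₁` of
exact functors. -/
noncomputable def coneDerived : DerivedCategory A ⥤ DerivedCategory B :=
  (coneLocalizerMorphism δ).localizedFunctor DerivedCategory.Q DerivedCategory.Q

/-- On complexes, `coneDerived δ` is given by the cone of `δ`. -/
noncomputable def coneDerivedIso : coneFunctor δ ⋙ DerivedCategory.Q ≅
    DerivedCategory.Q ⋙ coneDerived δ :=
  CatCommSq.iso (coneLocalizerMorphism δ).functor DerivedCategory.Q DerivedCategory.Q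
    ((coneLocalizerMorphism δ).localizedFunctor DerivedCategory.Q DerivedCategory.Q)

noncomputable instance : (coneLocalizerMorphism δ).functor.CommShift ℤ :=
  inferInstanceAs ((coneFunctor δ).CommShift ℤ)

noncomputable instance : (coneDerived δ).CommShift ℤ :=
  (coneLocalizerMorphism δ).commShift ℤ DerivedCategory.Q DerivedCategory.Q _ (coneDerivedIso δ)

instance : NatTrans.CommShift (coneDerivedIso δ).hom ℤ :=
  (coneLocalizerMorphism δ).natTransCommShift_hom DerivedCategory.Q DerivedCategory.Q _
    (coneDerivedIso δ)

instance : (coneDerived δ).IsTriangulated where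
  map_distinguished T hT := by
    obtain ⟨K, L, f, ⟨e⟩⟩ := (DerivedCategory.mem_distTriang_iff T).1 hT
    exact isomorphic_distinguished _ (coneFunctor_mapTriangle_distinguished δ f) _
      ((coneDerived δ).mapTriangle.mapIso e ≪≫
        (Functor.mapTriangleCompIso DerivedCategory.Q (coneDerived δ)).symm.app _ ≪≫
        (Functor.mapTriangleIso (coneDerivedIso δ)).symm.app _)

open DerivedCategory.TStructure in
lemma coneDerived_bounded (X : DerivedCategory A) (hX : t.bounded X) :
    t.bounded ((coneDerived δ).obj X) := by
  obtain ⟨⟨a, ha⟩, ⟨b, hb⟩⟩ := hX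
  have : X.IsGE a := ha
  have : X.IsLE b := hb
  obtain ⟨K, _, _, ⟨e⟩⟩ := X.exists_iso_Q_obj_of_isGE_of_isLE a b
  have e' : (coneDerived δ).obj X ≅ DerivedCategory.Q.obj (coneObj δ K) :=
    (coneDerived δ).mapIso e ≪≫ (coneDerivedIso δ).symm.app K
  have h₁ : (coneObj δ K).IsStrictlyGE (a - 1) := by
    rw [CochainComplex.isStrictlyGE_iff]
    intro i hi
    exact isZero_coneObj_X δ (K.isZero_of_isStrictlyGE a (i + 1) (by lia))
      (K.isZero_of_isStrictlyGE a i (by lia))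
  have h₂ : (coneObj δ K).IsStrictlyLE b := by
    rw [CochainComplex.isStrictlyLE_iff]
    intro i hi
    exact isZero_coneObj_X δ (K.isZero_of_isStrictlyLE b (i + 1) (by lia))
      (K.isZero_of_isStrictlyLE b i (by lia))
  exact ⟨⟨a - 1, ⟨_, e', h₁⟩⟩, ⟨b, ⟨_, e', h₂⟩⟩⟩

end CategoryTheory.NatTrans

/-! ### Equivalences of bounded derived categories -/

namespace DerivedCategory

open TStructure

section

variable (A B : Type*) [Category* A] [Category* B] [Abelian A] [Abelian B]
  [HasDerivedCategory A] [HasDerivedCategory B]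

/-- The bounded derived categories of `A` and `B` are equivalent as triangulated categories. -/
def BoundedEquivalent : Prop :=
  ∃ (e : Bounded A ≌ Bounded B) (_ : e.functor.CommShift ℤ), e.functor.IsTriangulated

end

variable {A B C : Type*} [Category* A] [Category* B] [Category* C] [Abelian A] [Abelian B]
  [Abelian C] [HasDerivedCategory A] [HasDerivedCategory B] [HasDerivedCategory C]

lemma boundedEquivalent_of_isEquivalence (F : Bounded A ⥤ Bounded B) [F.IsEquivalence]
    [h : F.CommShift ℤ] [h' : F.IsTriangulated] : BoundedEquivalent A B :=
  ⟨F.asEquivalence, h, h'⟩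

lemma BoundedEquivalent.trans (h₁ : BoundedEquivalent A B) (h₂ : BoundedEquivalent B C) :
    BoundedEquivalent A C := by
  obtain ⟨e₁, _, _⟩ := h₁
  obtain ⟨e₂, _, _⟩ := h₂
  exact boundedEquivalent_of_isEquivalence (e₁.functor ⋙ e₂.functor)

/-- Triangulated functors in opposite directions that preserve boundedness and whose two
composites are shifts give an equivalence of bounded derived categories. -/
lemma boundedEquivalent_of_iso_shift (F : DerivedCategory A ⥤ DerivedCategory B)
    (G : DerivedCategory B ⥤ DerivedCategory A) [F.CommShift ℤ] [F.IsTriangulated]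
    (hF : ∀ X, t.bounded X → t.bounded (F.obj X)) (hG : ∀ X, t.bounded X → t.bounded (G.obj X))
    (n m : ℤ) (e : F ⋙ G ≅ shiftFunctor _ n) (e' : G ⋙ F ≅ shiftFunctor _ m) :
    BoundedEquivalent A B := by
  have : (F ⋙ G).Faithful := Functor.Faithful.of_iso e.symm
  have : (G ⋙ F).Faithful := Functor.Faithful.of_iso e'.symm
  have : F.Faithful := Functor.Faithful.of_comp F G
  have : G.Faithful := Functor.Faithful.of_comp G F
  have : F.Full := Functor.Full.of_comp_faithful_iso e
  let F' : Bounded A ⥤ Bounded B := t.bounded.lift (t.bounded.ι ⋙ F) fun X => hF _ X.2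
  have : F'.EssSurj := ⟨fun Y => ⟨⟨G.obj (Y.1⟦-m⟧), hG _ (t.bounded.le_shift (-m) _ Y.2)⟩,
    ⟨t.bounded.fullyFaithfulι.preimageIso (e'.app _ ≪≫ shiftNegShift Y.1 m)⟩⟩⟩
  have : F'.IsEquivalence := {}
  exact boundedEquivalent_of_isEquivalence (h := inferInstanceAs ((t.bounded.lift _ _).CommShift ℤ))
    (h' := inferInstanceAs (t.bounded.lift _ _).IsTriangulated) F'

end DerivedCategory

section

variable {A B : Type*} [Category* A] [Category* B] [Abelian A] [Abelian B]
  [HasDerivedCategory A] [HasDerivedCategory B]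

open DerivedCategory TStructure

lemma CategoryTheory.Functor.mapDerivedCategory_bounded (F : A ⥤ B) [F.Additive]
    [PreservesFiniteLimits F]
    [PreservesFiniteColimits F] (X : DerivedCategory A) (hX : t.bounded X) :
    t.bounded (F.mapDerivedCategory.obj X) := by
  obtain ⟨⟨a, ha⟩, ⟨b, hb⟩⟩ := hX
  have : X.IsGE a := ha
  have : X.IsLE b := hb
  obtain ⟨K, _, _, ⟨e⟩⟩ := X.exists_iso_Q_obj_of_isGE_of_isLE a b
  have e' := F.mapDerivedCategory.mapIso e ≪≫ F.mapDerivedCategoryFactors.app K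
  have h₁ : CochainComplex.IsStrictlyGE
      ((F.mapHomologicalComplex (ComplexShape.up ℤ)).obj K) a := by
    rw [CochainComplex.isStrictlyGE_iff]
    exact fun i hi => F.map_isZero (K.isZero_of_isStrictlyGE a i hi)
  have h₂ : CochainComplex.IsStrictlyLE
      ((F.mapHomologicalComplex (ComplexShape.up ℤ)).obj K) b := by
    rw [CochainComplex.isStrictlyLE_iff]
    exact fun i hi => F.map_isZero (K.isZero_of_isStrictlyLE b i hi)
  exact ⟨⟨a, ⟨_, e', h₁⟩⟩, ⟨b, ⟨_, e', h₂⟩⟩⟩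

/-- Exact functors with `F ⋙ G ≅ 𝟭 A` satisfy the same on derived categories. -/
noncomputable def CategoryTheory.Functor.mapDerivedCategoryCompIso (F : A ⥤ B) (G : B ⥤ A)
    [F.Additive] [G.Additive]
    [PreservesFiniteLimits F] [PreservesFiniteColimits F] [PreservesFiniteLimits G]
    [PreservesFiniteColimits G] (e : F ⋙ G ≅ 𝟭 A) :
    F.mapDerivedCategory ⋙ G.mapDerivedCategory ≅ 𝟭 (DerivedCategory A) :=
  Localization.liftNatIso Q (HomologicalComplex.quasiIso A (ComplexShape.up ℤ))
    (Q ⋙ F.mapDerivedCategory ⋙ G.mapDerivedCategory) Q _ _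
    (Functor.isoWhiskerRight F.mapDerivedCategoryFactors G.mapDerivedCategory ≪≫
      Functor.isoWhiskerLeft (F.mapHomologicalComplex _) G.mapDerivedCategoryFactors ≪≫
      Functor.isoWhiskerRight (NatIso.ofComponents (fun K => HomologicalComplex.Hom.isoOfComponents
        (fun i => e.app (K.X i)) (fun i j _ => (e.hom.naturality (K.d i j)).symm))
        (fun f => by ext i; exact e.hom.naturality (f.f i)) :
          F.mapHomologicalComplex _ ⋙ G.mapHomologicalComplex _ ≅
            𝟭 (CochainComplex A ℤ)) Q)

lemma CategoryTheory.Equivalence.boundedEquivalent (e : A ≌ B) : BoundedEquivalent A B := by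
  have : e.functor.Additive := Functor.additive_of_preserves_binary_products _
  have : e.inverse.Additive := Functor.additive_of_preserves_binary_products _
  exact boundedEquivalent_of_iso_shift e.functor.mapDerivedCategory e.inverse.mapDerivedCategory
    (Functor.mapDerivedCategory_bounded _) (Functor.mapDerivedCategory_bounded _) 0 0
    (Functor.mapDerivedCategoryCompIso _ _ e.unitIso.symm ≪≫ (shiftFunctorZero _ _).symm)
    (Functor.mapDerivedCategoryCompIso _ _ e.counitIso ≪≫ (shiftFunctorZero _ _).symm)

end

/-! ### Mutually inverse cones from bicartesian squares -/

namespace CategoryTheory.NatTrans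

section

variable {A B C : Type*} [Category* A] [Category* B] [Category* C]
  [Preadditive A] [Preadditive B] [Preadditive C] [HasBinaryBiproducts B]
  {M₀ M₁ : A ⥤ B} [M₀.Additive] [M₁.Additive] (δ : M₀ ⟶ M₁)
  (F : B ⥤ C) [F.Additive] (K : CochainComplex A ℤ)

@[simp]
lemma map_coneInl_fst (i j : ℤ) (h : i + 1 = j) :
    F.map (coneInl δ K i j h) ≫ F.map (coneFst δ K i j h) = 𝟙 _ := by
  rw [← F.map_comp, coneInl_fst, F.map_id]

@[simp]
lemma map_coneInr_snd (i : ℤ) :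
    F.map (coneInr δ K i) ≫ F.map (coneSnd δ K i) = 𝟙 _ := by
  rw [← F.map_comp, coneInr_snd, F.map_id]

@[simp]
lemma map_coneInl_snd (i j : ℤ) (h : i + 1 = j) :
    F.map (coneInl δ K i j h) ≫ F.map (coneSnd δ K i) = 0 := by
  rw [← F.map_comp, coneInl_snd, F.map_zero]

@[simp]
lemma map_coneInr_fst (i j : ℤ) (h : i + 1 = j) :
    F.map (coneInr δ K i) ≫ F.map (coneFst δ K i j h) = 0 := by
  rw [← F.map_comp, coneInr_fst, F.map_zero]

@[simp]
lemma map_coneInl_fst_assoc (i j : ℤ) (h : i + 1 = j) {Z : C} (φ : _ ⟶ Z) :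
    F.map (coneInl δ K i j h) ≫ F.map (coneFst δ K i j h) ≫ φ = φ := by
  rw [← Category.assoc, map_coneInl_fst, Category.id_comp]

@[simp]
lemma map_coneInr_snd_assoc (i : ℤ) {Z : C} (φ : _ ⟶ Z) :
    F.map (coneInr δ K i) ≫ F.map (coneSnd δ K i) ≫ φ = φ := by
  rw [← Category.assoc, map_coneInr_snd, Category.id_comp]

@[simp]
lemma map_coneInl_snd_assoc (i j : ℤ) (h : i + 1 = j) {Z : C} (φ : _ ⟶ Z) :
    F.map (coneInl δ K i j h) ≫ F.map (coneSnd δ K i) ≫ φ = 0 := by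
  rw [← Category.assoc, map_coneInl_snd, zero_comp]

@[simp]
lemma map_coneInr_fst_assoc (i j : ℤ) (h : i + 1 = j) {Z : C} (φ : _ ⟶ Z) :
    F.map (coneInr δ K i) ≫ F.map (coneFst δ K i j h) ≫ φ = 0 := by
  rw [← Category.assoc, map_coneInr_fst, zero_comp]

@[simp]
lemma map_d_coneFst (i j l : ℤ) (h : i + 1 = j) (h' : j + 1 = l) :
    F.map ((coneObj δ K).d i j) ≫ F.map (coneFst δ K j l h') =
      F.map (coneFst δ K i j h) ≫ F.map (M₀.map (K.d j l)) := by
  rw [← F.map_comp, d_coneFst δ K i j l h h', F.map_comp]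

@[simp]
lemma map_d_coneFst_assoc (i j l : ℤ) (h : i + 1 = j) (h' : j + 1 = l) {Z : C} (φ : _ ⟶ Z) :
    F.map ((coneObj δ K).d i j) ≫ F.map (coneFst δ K j l h') ≫ φ =
      F.map (coneFst δ K i j h) ≫ F.map (M₀.map (K.d j l)) ≫ φ := by
  rw [← Category.assoc, map_d_coneFst δ F K i j l h h', Category.assoc]

@[simp]
lemma map_d_coneSnd (i j : ℤ) (h : i + 1 = j) :
    F.map ((coneObj δ K).d i j) ≫ F.map (coneSnd δ K j) =
      F.map (coneSnd δ K i) ≫ F.map (M₁.map (K.d i j)) +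
        i.negOnePow • (F.map (coneFst δ K i j h) ≫ F.map (δ.app (K.X j))) := by
  rw [← F.map_comp, d_coneSnd δ K i j h, F.map_add, F.map_units_smul, F.map_comp, F.map_comp]

@[simp]
lemma map_d_coneSnd_assoc (i j : ℤ) (h : i + 1 = j) {Z : C} (φ : _ ⟶ Z) :
    F.map ((coneObj δ K).d i j) ≫ F.map (coneSnd δ K j) ≫ φ =
      F.map (coneSnd δ K i) ≫ F.map (M₁.map (K.d i j)) ≫ φ +
        i.negOnePow • (F.map (coneFst δ K i j h) ≫ F.map (δ.app (K.X j)) ≫ φ) := by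
  rw [← Category.assoc, map_d_coneSnd δ F K i j h]
  simp [Linear.units_smul_comp]

@[simp]
lemma map_coneMap_fst {K L : CochainComplex A ℤ} (f : K ⟶ L) (i j : ℤ) (h : i + 1 = j) :
    F.map ((coneMap δ f).f i) ≫ F.map (coneFst δ L i j h) =
      F.map (coneFst δ K i j h) ≫ F.map (M₀.map (f.f j)) := by
  rw [← F.map_comp, coneMap_fst, F.map_comp]

@[simp]
lemma map_coneMap_snd {K L : CochainComplex A ℤ} (f : K ⟶ L) (i : ℤ) :
    F.map ((coneMap δ f).f i) ≫ F.map (coneSnd δ L i) =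
      F.map (coneSnd δ K i) ≫ F.map (M₁.map (f.f i)) := by
  rw [← F.map_comp, coneMap_snd, F.map_comp]

@[simp]
lemma map_coneMap_fst_assoc {K L : CochainComplex A ℤ} (f : K ⟶ L) (i j : ℤ) (h : i + 1 = j)
    {Z : C} (φ : _ ⟶ Z) :
    F.map ((coneMap δ f).f i) ≫ F.map (coneFst δ L i j h) ≫ φ =
      F.map (coneFst δ K i j h) ≫ F.map (M₀.map (f.f j)) ≫ φ := by
  rw [← Category.assoc, map_coneMap_fst, Category.assoc]

@[simp]
lemma map_coneMap_snd_assoc {K L : CochainComplex A ℤ} (f : K ⟶ L) (i : ℤ)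
    {Z : C} (φ : _ ⟶ Z) :
    F.map ((coneMap δ f).f i) ≫ F.map (coneSnd δ L i) ≫ φ =
      F.map (coneSnd δ K i) ≫ F.map (M₁.map (f.f i)) ≫ φ := by
  rw [← Category.assoc, map_coneMap_snd, Category.assoc]

variable {δ F K} in
lemma map_cone_to_ext {i : ℤ} (j : ℤ) (h : i + 1 = j) {Y : C}
    {f g : Y ⟶ F.obj ((coneObj δ K).X i)}
    (h₀ : f ≫ F.map (coneFst δ K i j h) = g ≫ F.map (coneFst δ K i j h))
    (h₁ : f ≫ F.map (coneSnd δ K i) = g ≫ F.map (coneSnd δ K i)) : f = g := by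
  have := congrArg F.map (cone_id δ K i j h)
  rw [F.map_id, F.map_add, F.map_comp, F.map_comp] at this
  rw [← Category.comp_id f, ← Category.comp_id g, ← this]
  simp [reassoc_of% h₀, reassoc_of% h₁]

end

variable {A B : Type*} [Category* A] [Category* B] [Abelian A] [Abelian B]
  {M₀ M₁ : A ⥤ B} [M₀.Additive] [M₁.Additive] (δ : M₀ ⟶ M₁)
  {N₀ N₁ : B ⥤ A} [N₀.Additive] [N₁.Additive] (ε : N₀ ⟶ N₁)

attribute [-simp] CochainComplex.shiftFunctor_obj_X' CochainComplex.shiftFunctor_map_f'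
  CochainComplex.shiftFunctor_obj_d'

section

variable (u : M₁ ⋙ N₀ ⟶ 𝟭 A) (v : M₀ ⋙ N₁ ⟶ 𝟭 A)

/-- The map from the iterated cone, with summands `N₀M₀`, `N₀M₁`, `N₁M₀`, `N₁M₁`, to the shift,
in a single degree: it is given by `u` on `N₀M₁` and by `v` on `N₁M₀`. The sign `(-1)^i` makes it
commute with the differentials. -/
noncomputable def coneConeToShiftX (K : CochainComplex A ℤ) (i : ℤ) :
    (coneObj ε (coneObj δ K)).X i ⟶ (K⟦(1 : ℤ)⟧).X i :=
  i.negOnePow • ((coneFst ε (coneObj δ K) i (i + 1) rfl ≫ N₀.map (coneSnd δ K (i + 1)) ≫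
    u.app (K.X (i + 1)) + coneSnd ε (coneObj δ K) i ≫ N₁.map (coneFst δ K i (i + 1) rfl) ≫
      v.app (K.X (i + 1))) ≫ (K.shiftX 1 i).inv)

variable {u v}

variable (sq : ∀ X, BicartesianSq (N₀.map (δ.app X)) (ε.app (M₀.obj X)) (u.app X) (v.app X))

include sq in
lemma coneConeToShiftX_comm (K : CochainComplex A ℤ) (i : ℤ) :
    coneConeToShiftX δ ε u v K i ≫ (K⟦(1 : ℤ)⟧).d i (i + 1) =
      (coneObj ε (coneObj δ K)).d i (i + 1) ≫ coneConeToShiftX δ ε u v K (i + 1) := by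
  have hu := u.naturality (K.d (i + 1) (i + 1 + 1))
  have hv := v.naturality (K.d (i + 1) (i + 1 + 1))
  have hw : N₀.map (δ.app (K.X (i + 1 + 1))) ≫ u.app (K.X (i + 1 + 1)) =
    ε.app (M₀.obj (K.X (i + 1 + 1))) ≫ v.app (K.X (i + 1 + 1)) := (sq _).w
  dsimp only [Functor.comp_obj, Functor.id_obj, Functor.comp_map, Functor.id_map] at hu hv
  simp only [coneConeToShiftX, Linear.units_smul_comp, Linear.comp_units_smul, Category.assoc,
    CochainComplex.shiftX_inv_d]
  simp [reassoc_of% hu, reassoc_of% hv, reassoc_of% hw, smul_smul,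
    Int.negOnePow_succ]
  abel

/-- The maps `coneConeToShiftX`, as a morphism of complexes. -/
noncomputable def coneConeToShift (K : CochainComplex A ℤ) :
    coneObj ε (coneObj δ K) ⟶ K⟦(1 : ℤ)⟧ where
  f i := coneConeToShiftX δ ε u v K i
  comm' := by
    rintro i _ rfl
    exact coneConeToShiftX_comm δ ε sq K i

/-- The map from the iterated cone to the shift, as a natural transformation. -/
noncomputable def coneConeToShiftNatTrans :
    coneFunctor δ ⋙ coneFunctor ε ⟶ shiftFunctor (CochainComplex A ℤ) (1 : ℤ) where
  app K := coneConeToShift δ ε sq K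
  naturality K L f := by
    ext i
    change (coneMap ε (coneMap δ f)).f i ≫ coneConeToShiftX δ ε u v L i =
      coneConeToShiftX δ ε u v K i ≫ (f⟦(1 : ℤ)⟧').f i
    have hu := u.naturality (f.f (i + 1))
    have hv := v.naturality (f.f (i + 1))
    dsimp only [Functor.comp_obj, Functor.id_obj, Functor.comp_map, Functor.id_map] at hu hv
    simp [coneConeToShiftX, CochainComplex.shiftX_inv_naturality, Linear.units_smul_comp,
      Linear.comp_units_smul, reassoc_of% hu, reassoc_of% hv]

lemma epi_coneConeToShift_f (K : CochainComplex A ℤ) (i : ℤ) :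
    Epi ((coneConeToShift δ ε sq K).f i) := by
  have := (sq (K.X (i + 1))).toIsPushout
  refine Preadditive.epi_of_cancel_zero _ fun {Z} g hg => ?_
  have h₁ := (N₀.map (coneInr δ K (i + 1)) ≫ coneInl ε (coneObj δ K) i (i + 1) rfl) ≫= hg
  have h₂ := (N₁.map (coneInl δ K i (i + 1) rfl) ≫ coneInr ε (coneObj δ K) i) ≫= hg
  change _ ≫ coneConeToShiftX δ ε u v K i ≫ g = _ at h₁ h₂
  rw [← cancel_epi (K.shiftX 1 i).inv]
  refine this.hom_ext ?_ ?_
  · simpa [coneConeToShiftX, Linear.units_smul_comp, Linear.comp_units_smul, smul_eq_zero_iff_eq]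
      using h₁
  · simpa [coneConeToShiftX, Linear.units_smul_comp, Linear.comp_units_smul, smul_eq_zero_iff_eq]
      using h₂

/-- If `N₁M₁ = 0` and `N₀M₀ ⟶ N₀M₁ ⊕ N₁M₀ ⟶ 𝟭` is a short exact sequence, then the iterated cone
is a resolution of the shift of the identity. A cycle `x` in the kernel of the map is corrected by
the boundary of an `N₀M₀`-chain `q`, which the pullback property provides, to a cycle `z`; all
components of `z` vanish. -/
lemma quasiIso_coneConeToShift (hNM : ∀ X, IsZero (N₁.obj (M₁.obj X)))
    (K : CochainComplex A ℤ) : QuasiIso (coneConeToShift δ ε sq K) := by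
  have := epi_coneConeToShift_f δ ε sq K
  refine CochainComplex.quasiIso_of_epi _ fun i T x hx hxd => ?_
  have pb (n : ℤ) := (sq (K.X n)).toIsPullback
  change x ≫ coneConeToShiftX δ ε u v K (i + 1) = 0 at hx
  have hx' : (x ≫ coneFst ε (coneObj δ K) (i + 1) (i + 1 + 1) rfl ≫
      N₀.map (coneSnd δ K (i + 1 + 1))) ≫ u.app _ =
      (-x ≫ coneSnd ε (coneObj δ K) (i + 1) ≫ N₁.map (coneFst δ K (i + 1) (i + 1 + 1) rfl)) ≫
        v.app _ := by
    simp only [coneConeToShiftX, Linear.comp_units_smul, smul_eq_zero_iff_eq] at hx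
    rw [← cancel_mono (K.shiftX 1 (i + 1)).inv]
    simpa [eq_neg_iff_add_eq_zero] using hx
  let q := (pb (i + 1 + 1)).lift _ _ hx'
  have hq₁ : q ≫ N₀.map (δ.app _) = _ := (pb (i + 1 + 1)).lift_fst _ _ hx'
  have hq₂ : q ≫ ε.app _ = _ := (pb (i + 1 + 1)).lift_snd _ _ hx'
  let y := (i + 1).negOnePow • (q ≫ N₀.map (coneInl δ K (i + 1) (i + 1 + 1) rfl) ≫
    coneInl ε (coneObj δ K) i (i + 1) rfl)
  refine ⟨T, 𝟙 T, inferInstance, y, ?_, ?_⟩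
  · change y ≫ coneConeToShiftX δ ε u v K i = 0
    simp [coneConeToShiftX, y]
  obtain ⟨z, hz⟩ : ∃ z, z = x - y ≫ (coneObj ε (coneObj δ K)).d i (i + 1) := ⟨_, rfl⟩
  have hzd : z ≫ (coneObj ε (coneObj δ K)).d (i + 1) (i + 1 + 1) = 0 := by simp [hz, hxd]
  have hz₁ : z ≫ coneFst ε (coneObj δ K) (i + 1) (i + 1 + 1) rfl ≫
      N₀.map (coneSnd δ K (i + 1 + 1)) = 0 := by
    simp [hz, y, Linear.units_smul_comp, Linear.comp_units_smul, hq₁, smul_smul]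
  have hz₂ : z ≫ coneSnd ε (coneObj δ K) (i + 1) ≫
      N₁.map (coneFst δ K (i + 1) (i + 1 + 1) rfl) = 0 := by
    simp [hz, y, Linear.units_smul_comp, Linear.comp_units_smul, hq₂, smul_smul,
      Int.negOnePow_succ]
  have hz₃ : z ≫ coneFst ε (coneObj δ K) (i + 1) (i + 1 + 1) rfl ≫
      N₀.map (coneFst δ K (i + 1 + 1) (i + 1 + 1 + 1) rfl) = 0 := by
    refine (pb _).hom_ext ?_ ?_
    · have := hzd =≫ (coneFst ε (coneObj δ K) _ _ rfl ≫ N₀.map (coneSnd δ K _))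
      simpa [reassoc_of% hz₁, Linear.comp_units_smul, smul_eq_zero_iff_eq] using this
    · have := hzd =≫ (coneSnd ε (coneObj δ K) _ ≫ N₁.map (coneFst δ K _ _ rfl))
      simpa [reassoc_of% hz₂, Linear.comp_units_smul, smul_eq_zero_iff_eq] using this
  rw [Category.id_comp, ← sub_eq_zero, ← hz]
  apply cone_to_ext _ rfl
  · apply map_cone_to_ext _ rfl <;> simpa
  · apply map_cone_to_ext _ rfl
    · simpa
    · exact (hNM _).eq_of_tgt _ _

end
section

variable (a : 𝟭 B ⟶ N₁ ⋙ M₀) (b : 𝟭 B ⟶ N₀ ⋙ M₁)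

/-- The map from the shift to the iterated cone in the opposite order, in a single degree: it is
given by `a` into `M₀N₁` and by `-b` into `M₁N₀`. The signs make it commute with the
differentials. -/
noncomputable def shiftToConeConeX (K : CochainComplex B ℤ) (i : ℤ) :
    (K⟦(1 : ℤ)⟧).X i ⟶ (coneObj δ (coneObj ε K)).X i :=
  i.negOnePow • ((K.shiftX 1 i).hom ≫
    (a.app (K.X (i + 1)) ≫ M₀.map (coneInr ε K (i + 1)) ≫
        coneInl δ (coneObj ε K) i (i + 1) rfl -
      b.app (K.X (i + 1)) ≫ M₁.map (coneInl ε K i (i + 1) rfl) ≫ coneInr δ (coneObj ε K) i))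

variable {a b}

variable (sq : ∀ Y, BicartesianSq (a.app Y) (b.app Y) (δ.app (N₁.obj Y)) (M₁.map (ε.app Y)))

include sq in
lemma shiftToConeConeX_comm (K : CochainComplex B ℤ) (i : ℤ) :
    shiftToConeConeX δ ε a b K i ≫ (coneObj δ (coneObj ε K)).d i (i + 1) =
      (K⟦(1 : ℤ)⟧).d i (i + 1) ≫ shiftToConeConeX δ ε a b K (i + 1) := by
  have ha := a.naturality (K.d (i + 1) (i + 1 + 1))
  have hb := b.naturality (K.d (i + 1) (i + 1 + 1))
  have hw : a.app (K.X (i + 1)) ≫ δ.app (N₁.obj (K.X (i + 1))) =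
    b.app (K.X (i + 1)) ≫ M₁.map (ε.app (K.X (i + 1))) := (sq _).w
  dsimp only [Functor.comp_obj, Functor.id_obj, Functor.comp_map, Functor.id_map] at ha hb
  simp only [shiftToConeConeX, Linear.units_smul_comp, Linear.comp_units_smul, Category.assoc,
    CochainComplex.d_shiftX_assoc]
  apply cone_to_ext _ rfl
  · apply map_cone_to_ext _ rfl
    · simp [Linear.units_smul_comp, Linear.comp_units_smul]
    · simp [Linear.units_smul_comp, Linear.comp_units_smul, ha, Int.negOnePow_succ]
  · apply map_cone_to_ext _ rfl
    · simp [Linear.units_smul_comp, Linear.comp_units_smul, hb, Int.negOnePow_succ]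
    · simp [Linear.units_smul_comp, Linear.comp_units_smul, hw]

/-- The maps `shiftToConeConeX`, as a morphism of complexes. -/
noncomputable def shiftToConeCone (K : CochainComplex B ℤ) :
    K⟦(1 : ℤ)⟧ ⟶ coneObj δ (coneObj ε K) where
  f i := shiftToConeConeX δ ε a b K i
  comm' := by
    rintro i _ rfl
    exact shiftToConeConeX_comm δ ε sq K i

/-- The map from the shift to the iterated cone, as a natural transformation. -/
noncomputable def shiftToConeConeNatTrans :
    shiftFunctor (CochainComplex B ℤ) (1 : ℤ) ⟶ coneFunctor ε ⋙ coneFunctor δ where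
  app K := shiftToConeCone δ ε sq K
  naturality K L f := by
    ext i
    change (f⟦(1 : ℤ)⟧').f i ≫ shiftToConeConeX δ ε a b L i =
      shiftToConeConeX δ ε a b K i ≫ (coneMap δ (coneMap ε f)).f i
    have ha := a.naturality (f.f (i + 1))
    have hb := b.naturality (f.f (i + 1))
    dsimp only [Functor.comp_obj, Functor.id_obj, Functor.comp_map, Functor.id_map] at ha hb
    simp only [shiftToConeConeX, Linear.units_smul_comp, Linear.comp_units_smul, Category.assoc,
      CochainComplex.shiftX_naturality_assoc]
    apply cone_to_ext _ rfl
    · apply map_cone_to_ext _ rfl <;>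
      simp [Linear.units_smul_comp, ha]
    · apply map_cone_to_ext _ rfl <;>
      simp [Linear.units_smul_comp, hb]

lemma mono_shiftToConeCone_f (K : CochainComplex B ℤ) (i : ℤ) :
    Mono ((shiftToConeCone δ ε sq K).f i) := by
  have := (sq (K.X (i + 1))).toIsPullback
  refine Preadditive.mono_of_cancel_zero _ fun {Z} g hg => ?_
  change g ≫ shiftToConeConeX δ ε a b K i = 0 at hg
  have h₁ := hg =≫ (coneFst δ (coneObj ε K) i (i + 1) rfl ≫ M₀.map (coneSnd ε K (i + 1)))
  have h₂ := hg =≫ (coneSnd δ (coneObj ε K) i ≫ M₁.map (coneFst ε K i (i + 1) rfl))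
  rw [← cancel_mono (K.shiftX 1 i).hom]
  refine this.hom_ext ?_ ?_
  · simpa [shiftToConeConeX, Linear.units_smul_comp, Linear.comp_units_smul,
      smul_eq_zero_iff_eq] using h₁
  · simpa [shiftToConeConeX, Linear.units_smul_comp, Linear.comp_units_smul,
      smul_eq_zero_iff_eq] using h₂

/-- If `M₀N₀ = 0` and `𝟭 ⟶ M₀N₁ ⊕ M₁N₀ ⟶ M₁N₁` is a short exact sequence, then the iterated cone
is a coresolution of the shift of the identity. A chain `x` that is a cycle modulo the image is
corrected, up to a refinement, by the boundary of a lift `c` of its `M₁N₁`-component; the pullback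
property shows that what remains lies in the image. -/
lemma quasiIso_shiftToConeCone (hMN : ∀ Y, IsZero (M₀.obj (N₀.obj Y)))
    (K : CochainComplex B ℤ) : QuasiIso (shiftToConeCone δ ε sq K) := by
  have := mono_shiftToConeCone_f δ ε sq K
  refine CochainComplex.quasiIso_of_mono _ fun i T x z hxz => ?_
  change _ = z ≫ shiftToConeConeX δ ε a b K (i + 1 + 1) at hxz
  have pb (n : ℤ) := (sq (K.X n)).toIsPullback
  have : Epi (biprod.desc (δ.app (N₁.obj (K.X (i + 1)))) (M₁.map (ε.app (K.X (i + 1))))) := by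
    refine Preadditive.epi_of_cancel_zero _ fun {Z} g hg => ?_
    refine (sq (K.X (i + 1))).toIsPushout.hom_ext ?_ ?_
    · simpa using biprod.inl ≫= hg
    · simpa using biprod.inr ≫= hg
  obtain ⟨T', π, _, c, hc⟩ := surjective_up_to_refinements_of_epi
    (biprod.desc (δ.app (N₁.obj (K.X (i + 1)))) (M₁.map (ε.app (K.X (i + 1)))))
    (x ≫ coneSnd δ (coneObj ε K) (i + 1) ≫ M₁.map (coneSnd ε K (i + 1)))
  let y := i.negOnePow • ((c ≫ biprod.fst) ≫ M₀.map (coneInr ε K (i + 1)) ≫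
      coneInl δ (coneObj ε K) i (i + 1) rfl +
    (c ≫ biprod.snd) ≫ M₁.map (coneInl ε K i (i + 1) rfl) ≫ coneInr δ (coneObj ε K) i)
  obtain ⟨x', hx'⟩ : ∃ x', x' = π ≫ x - y ≫ (coneObj δ (coneObj ε K)).d i (i + 1) := ⟨_, rfl⟩
  have hxd : x' ≫ (coneObj δ (coneObj ε K)).d (i + 1) (i + 1 + 1) =
    π ≫ z ≫ shiftToConeConeX δ ε a b K (i + 1 + 1) := by simp [hx', hxz]
  have hc' : π ≫ x ≫ coneSnd δ (coneObj ε K) (i + 1) ≫ M₁.map (coneSnd ε K (i + 1)) =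
      c ≫ biprod.fst ≫ δ.app _ + c ≫ biprod.snd ≫ M₁.map (ε.app _) := by
    rw [hc, biprod.desc_eq]
    simp
  have hx₁ : x' ≫ coneSnd δ (coneObj ε K) (i + 1) ≫ M₁.map (coneSnd ε K (i + 1)) = 0 := by
    simp [hx', hc', y, Linear.units_smul_comp, Linear.comp_units_smul, smul_smul]
  have hx₂ : (x' ≫ coneFst δ (coneObj ε K) (i + 1) (i + 1 + 1) rfl ≫
      M₀.map (coneSnd ε K (i + 1 + 1))) ≫ δ.app _ =
      (-x' ≫ coneSnd δ (coneObj ε K) (i + 1) ≫ M₁.map (coneFst ε K (i + 1) (i + 1 + 1) rfl)) ≫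
        M₁.map (ε.app _) := by
    have := hxd =≫ (coneSnd δ (coneObj ε K) _ ≫ M₁.map (coneSnd ε K _))
    simp [shiftToConeConeX, Linear.units_smul_comp, Linear.comp_units_smul, reassoc_of% hx₁]
      at this
    simpa [smul_smul] using
      congrArg ((i + 1).negOnePow • ·) (eq_neg_of_add_eq_zero_right this)
  let w := (pb (i + 1 + 1)).lift _ _ hx₂
  have hw₁ : w ≫ a.app _ = _ := (pb (i + 1 + 1)).lift_fst _ _ hx₂
  have hw₂ : w ≫ b.app _ = _ := (pb (i + 1 + 1)).lift_snd _ _ hx₂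
  refine ⟨T', π, inferInstance, y, (i + 1).negOnePow • (w ≫ (K.shiftX 1 (i + 1)).inv), ?_⟩
  change _ = _ + _ ≫ shiftToConeConeX δ ε a b K (i + 1)
  rw [← sub_eq_iff_eq_add', ← hx']
  apply cone_to_ext _ rfl
  · apply map_cone_to_ext _ rfl
    · exact (hMN _).eq_of_tgt _ _
    · simp [shiftToConeConeX, Linear.units_smul_comp, Linear.comp_units_smul, smul_smul, hw₁]
  · apply map_cone_to_ext _ rfl
    · simp [shiftToConeConeX, Linear.units_smul_comp, Linear.comp_units_smul, smul_smul, hw₂]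
    · simp [shiftToConeConeX, Linear.units_smul_comp, Linear.comp_units_smul, hx₁]

end

section

variable [HasDerivedCategory A] [HasDerivedCategory B] {u : M₁ ⋙ N₀ ⟶ 𝟭 A} {v : M₀ ⋙ N₁ ⟶ 𝟭 A}
  {a : 𝟭 B ⟶ N₁ ⋙ M₀} {b : 𝟭 B ⟶ N₀ ⋙ M₁}
  [PreservesFiniteLimits M₀] [PreservesFiniteColimits M₀]
  [PreservesFiniteLimits M₁] [PreservesFiniteColimits M₁]
  [PreservesFiniteLimits N₀] [PreservesFiniteColimits N₀]
  [PreservesFiniteLimits N₁] [PreservesFiniteColimits N₁]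

open _root_.DerivedCategory

/-- On complexes, the composite of two functors `coneDerived` is the iterated cone. -/
noncomputable def coneDerivedCompIso :
    Q ⋙ coneDerived δ ⋙ coneDerived ε ≅ (coneFunctor δ ⋙ coneFunctor ε) ⋙ Q :=
  Functor.isoWhiskerRight (coneDerivedIso δ).symm (coneDerived ε) ≪≫
    Functor.isoWhiskerLeft (coneFunctor δ) (coneDerivedIso ε).symm

/-- An identification of the iterated cone with the shift in the derived category descends to the
functors between derived categories. -/
noncomputable def coneDerivedCompIsoShift
    (e : (coneFunctor δ ⋙ coneFunctor ε) ⋙ Q ≅ shiftFunctor (CochainComplex A ℤ) (1 : ℤ) ⋙ Q) :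
    coneDerived δ ⋙ coneDerived ε ≅ shiftFunctor (DerivedCategory A) (1 : ℤ) :=
  Localization.liftNatIso Q (HomologicalComplex.quasiIso A (ComplexShape.up ℤ))
    (Q ⋙ coneDerived δ ⋙ coneDerived ε) (Q ⋙ shiftFunctor (DerivedCategory A) (1 : ℤ)) _ _
    (coneDerivedCompIso δ ε ≪≫ e ≪≫ Q.commShiftIso (1 : ℤ))

include δ ε in
/-- Let `δ : M₀ ⟶ M₁` and `ε : N₀ ⟶ N₁` be transformations of exact functors in opposite directions
such that `N₁M₁ = 0`, `M₀N₀ = 0`, and the identity functors complete the remaining three corners of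
the squares of composites to bicartesian squares. Then the cones of `δ` and `ε` are, up to shift,
inverse equivalences. -/
theorem boundedEquivalent_of_bicartesianSq
    (hNM : ∀ X, IsZero (N₁.obj (M₁.obj X))) (hMN : ∀ Y, IsZero (M₀.obj (N₀.obj Y)))
    (sqA : ∀ X, BicartesianSq (N₀.map (δ.app X)) (ε.app (M₀.obj X)) (u.app X) (v.app X))
    (sqB : ∀ Y, BicartesianSq (a.app Y) (b.app Y) (δ.app (N₁.obj Y)) (M₁.map (ε.app Y))) :
    BoundedEquivalent B A := by
  have h₁ (K : CochainComplex A ℤ) :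
      IsIso ((Functor.whiskerRight (coneConeToShiftNatTrans δ ε sqA) Q).app K) :=
    (isIso_Q_map_iff_quasiIso _ _).2 (quasiIso_coneConeToShift δ ε sqA hNM K)
  have h₂ (K : CochainComplex B ℤ) :
      IsIso ((Functor.whiskerRight (shiftToConeConeNatTrans δ ε sqB) Q).app K) :=
    (isIso_Q_map_iff_quasiIso _ _).2 (quasiIso_shiftToConeCone δ ε sqB hMN K)
  have := NatIso.isIso_of_isIso_app (Functor.whiskerRight (coneConeToShiftNatTrans δ ε sqA) Q)
  have := NatIso.isIso_of_isIso_app (Functor.whiskerRight (shiftToConeConeNatTrans δ ε sqB) Q)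
  exact boundedEquivalent_of_iso_shift (coneDerived ε) (coneDerived δ)
    (coneDerived_bounded ε) (coneDerived_bounded δ) 1 1
    (coneDerivedCompIsoShift ε δ
      (asIso (Functor.whiskerRight (shiftToConeConeNatTrans δ ε sqB) Q)).symm)
    (coneDerivedCompIsoShift δ ε
      (asIso (Functor.whiskerRight (coneConeToShiftNatTrans δ ε sqA) Q)))

end

end CategoryTheory.NatTrans

end

section

open Limits

/-! ### Representations of quivers with relations -/

section Representations

variable {k : Type u} [Field k] {V : Type} [Quiver.{0} V]

instance [Fintype V] : Fintype (Paths V) := inferInstanceAs (Fintype V)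

instance [DecidableEq V] : DecidableEq (Paths V) := inferInstanceAs (DecidableEq V)

/-- A path, as a morphism of the path category. -/
def Quiver.Path.hom {a b : V} (p : Quiver.Path a b) :
    (show Paths V from a) ⟶ (show Paths V from b) := p

lemma Quiver.Path.hom_nil (a : V) : (Quiver.Path.nil : Quiver.Path a a).hom = 𝟙 _ := rfl

lemma Quiver.Path.hom_comp {a b c : V} (p : Quiver.Path a b) (q : Quiver.Path b c) :
    (p.comp q).hom = p.hom ≫ q.hom := rfl

namespace PathAlgebra

variable [DecidableEq V] (W : Paths V ⥤ ModuleCat.{u} k)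

/-- The action of the path algebra on the direct sum of the vector spaces of a representation. -/
noncomputable def toEnd : PathAlgebra k V →ₗ[k] Module.End k (∀ v : Paths V, W.obj v) :=
  Finsupp.linearCombination k fun p : QuiverPath V =>
    LinearMap.single k (fun v : Paths V => W.obj v) p.target ∘ₗ (W.map p.path.hom).hom ∘ₗ
      LinearMap.proj (φ := fun v : Paths V => W.obj v) p.source

lemma toEnd_single {a b : V} (p : Quiver.Path a b) (x : ∀ v : Paths V, W.obj v) :
    toEnd W (single p) x = Pi.single (M := fun v : Paths V => W.obj v) b (W.map p.hom (x a)) := by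
  have : toEnd W (single p) = LinearMap.single k (fun v : Paths V => W.obj v) b ∘ₗ
      (W.map p.hom).hom ∘ₗ LinearMap.proj (φ := fun v : Paths V => W.obj v) a :=
    (Finsupp.linearCombination_single k (1 : k) (⟨a, b, p⟩ : QuiverPath V)).trans (one_smul _ _)
  rw [this]
  rfl

lemma toEnd_mul (x y : PathAlgebra k V) : toEnd W (x * y) = toEnd W x * toEnd W y := by
  rw [mul_def]
  induction x using induction_linear with
  | zero => simp
  | add x x' hx hx' => simp [hx, hx', add_mul]
  | smul r x hx => simp [hx]
  | @single b c p =>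
    induction y using induction_linear with
    | zero => simp
    | add y y' hy hy' => simp [hy, hy', mul_add]
    | smul r y hy => simp [hy]
    | @single a b' q =>
      rw [← mul_def]
      ext z : 1
      rw [Module.End.mul_apply, toEnd_single, toEnd_single]
      by_cases h : b' = b
      · subst h
        rw [single_mul_single, toEnd_single, Quiver.Path.hom_comp, W.map_comp]
        exact congrArg (fun t => Pi.single (M := fun v : Paths V => W.obj v) c (W.map p.hom t))
          (Pi.single_eq_same (M := fun v : Paths V => W.obj v) b' _).symm
      · rw [single_mul_single_of_ne _ _ h, map_zero]
        have h₀ := Pi.single_eq_of_ne (M := fun v : Paths V => W.obj v) (Ne.symm h)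
          (W.map q.hom (z a))
        refine Eq.symm ((congrArg (fun t => Pi.single (M := fun v : Paths V => W.obj v) c
          (W.map p.hom t)) h₀).trans ?_)
        simp only [map_zero]
        exact Pi.single_zero (M := fun v : Paths V => W.obj v) c

lemma toEnd_one [Fintype V] : toEnd W (1 : PathAlgebra k V) = 1 := by
  refine LinearMap.ext fun x => ?_
  rw [one_def, map_sum, LinearMap.sum_apply]
  simp only [toEnd_single, Quiver.Path.hom_nil]
  refine (Finset.sum_congr rfl fun d _ => ?_).trans (Finset.univ_sum_single x)
  exact congrArg (Pi.single (M := fun v : Paths V => W.obj v) d)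
    (congr($(W.map_id (show Paths V from d)) (x d)))

/-- The action of the path algebra, as a homomorphism of algebras. -/
noncomputable def toEndAlgHom [Fintype V] :
    PathAlgebra k V →ₐ[k] Module.End k (∀ v : Paths V, W.obj v) :=
  AlgHom.ofLinearMap (toEnd W) (toEnd_one W) (toEnd_mul W)

variable {W} in
lemma toEnd_naturality {W' : Paths V ⥤ ModuleCat.{u} k} (f : W ⟶ W') (x : PathAlgebra k V)
    (z : ∀ v : Paths V, W.obj v) :
    toEnd W' x (fun v => f.app v (z v)) = fun v => f.app v (toEnd W x z v) := by
  induction x using induction_linear with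
  | zero => ext v; simp
  | add x x' hx hx' => ext v; simp [hx, hx']
  | smul r x hx => ext v; simp [hx]
  | @single a b p =>
    rw [toEnd_single, toEnd_single]
    ext v
    by_cases h : v = b
    · subst h
      simp only [Pi.single_eq_same]
      exact (congr($(f.naturality p.hom) (z a))).symm
    · simp [Pi.single_eq_of_ne h]

/-- The representations of a quiver by finite-dimensional vector spaces that satisfy the relations
`r`, in the sense that related elements of the path algebra act in the same way. -/
def repProperty (r : PathAlgebra k V → PathAlgebra k V → Prop) :
    ObjectProperty (Paths V ⥤ ModuleCat.{u} k) := fun W =>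
  (∀ v, Module.Finite k (W.obj v)) ∧ ∀ x y, r x y → toEnd W x = toEnd W y

variable (r : PathAlgebra k V → PathAlgebra k V → Prop)

lemma repProperty_of_mono {W W' : Paths V ⥤ ModuleCat.{u} k} (f : W ⟶ W') [Mono f]
    (h : repProperty r W') : repProperty r W := by
  have hf (v) : Function.Injective (f.app v) := (ModuleCat.mono_iff_injective _).1 inferInstance
  refine ⟨fun v => ?_, fun x y hxy => ?_⟩
  · have := h.1 v
    exact Module.Finite.of_injective (f.app v).hom (hf v)
  · ext z : 1
    have h₁ := toEnd_naturality f x z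
    rw [h.2 x y hxy, toEnd_naturality] at h₁
    funext v
    exact (hf v (congrFun h₁ v)).symm

lemma repProperty_of_epi {W W' : Paths V ⥤ ModuleCat.{u} k} (f : W ⟶ W') [Epi f]
    (h : repProperty r W) : repProperty r W' := by
  have hf (v) : Function.Surjective (f.app v) := (ModuleCat.epi_iff_surjective _).1 inferInstance
  refine ⟨fun v => ?_, fun x y hxy => ?_⟩
  · have := h.1 v
    exact Module.Finite.of_surjective (f.app v).hom (hf v)
  · ext z : 1
    choose z' hz' using fun v => hf v (z v)
    obtain rfl : (fun v => f.app v (z' v)) = z := funext hz'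
    rw [toEnd_naturality, toEnd_naturality, h.2 x y hxy]

instance : (repProperty r).IsClosedUnderSubobjects where
  prop_of_mono f _ h := repProperty_of_mono r f h

instance : (repProperty r).IsClosedUnderQuotients where
  prop_of_epi f _ h := repProperty_of_epi r f h

instance : (repProperty r).ContainsZero where
  exists_zero := by
    have h : IsZero ((Functor.const (Paths V)).obj (ModuleCat.of k PUnit.{u + 1})) :=
      Functor.isZero _ fun _ =>
        ModuleCat.isZero_of_subsingleton (ModuleCat.of k PUnit.{u + 1})
    refine ⟨_, h, fun v => inferInstanceAs (Module.Finite k PUnit.{u + 1}), fun x y _ => ?_⟩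
    refine LinearMap.ext fun z => funext fun v => Subsingleton.elim (α := PUnit) _ _

instance : (repProperty r).IsClosedUnderFiniteProducts where
  isClosedUnderLimitsOfShape J _ := ⟨by
    rintro X ⟨h⟩
    have hX (v : Paths V) (x y : X.obj v)
        (hxy : ∀ j : J, (h.π.app ⟨j⟩).app v x = (h.π.app ⟨j⟩).app v y) : x = y :=
      Concrete.isLimit_ext _ (isLimitOfPreserves ((evaluation _ _).obj v) h.isLimit) x y
        fun ⟨j⟩ => hxy j
    have h₀ (j : J) := h.prop_diag_obj ⟨j⟩
    refine ⟨fun v => ?_, fun x y hxy => ?_⟩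
    · have (j : J) : Module.Finite k ((h.diag.obj ⟨j⟩).obj v) := (h₀ j).1 v
      refine Module.Finite.of_injective (LinearMap.pi fun j : J =>
        (((h.π.app ⟨j⟩).app v).hom : X.obj v →ₗ[k] (h.diag.obj ⟨j⟩).obj v)) ?_
      exact fun x y hxy => hX v x y fun j => congrFun hxy j
    · refine LinearMap.ext fun z => funext fun v => hX v _ _ fun j => ?_
      have h₁ := toEnd_naturality (h.π.app ⟨j⟩) x z
      rw [(h₀ j).2 x y hxy, toEnd_naturality] at h₁
      exact (congrFun h₁ v).symm⟩

/-- The category of finite-dimensional representations of a quiver with relations. -/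
abbrev Rep := (repProperty r).FullSubcategory

end PathAlgebra

end Representations

/-! ### The module of a representation -/

namespace PathAlgebra

variable {k : Type u} [Field k] {V : Type} [Quiver.{0} V] [Fintype V] [DecidableEq V]
  {r : PathAlgebra k V → PathAlgebra k V → Prop}

/-- The direct sum of the vector spaces of a representation, on which the bound path algebra acts.
It is a definition of its own, so that this module structure does not interfere with the
pointwise one. -/
def Total (W : Rep r) : Type u := ∀ v : Paths V, W.obj.obj v

namespace Total

variable (W : Rep r)

noncomputable instance : AddCommGroup (Total W) :=
  inferInstanceAs (AddCommGroup (∀ v : Paths V, W.obj.obj v))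

noncomputable instance : Module k (Total W) :=
  inferInstanceAs (Module k (∀ v : Paths V, W.obj.obj v))

/-- The action of the bound path algebra. -/
noncomputable def toEnd : RingQuot r →ₐ[k] Module.End k (Total W) :=
  RingQuot.liftAlgHom k ⟨toEndAlgHom W.obj, fun x y h => W.property.2 x y h⟩

noncomputable instance : Module (RingQuot r) (Total W) :=
  Module.compHom (Total W) (toEnd W).toRingHom

lemma mk_smul (x : PathAlgebra k V) (z : Total W) :
    RingQuot.mkAlgHom k r x • z = PathAlgebra.toEnd W.obj x z :=
  congr($(RingQuot.liftAlgHom_mkAlgHom_apply k (toEndAlgHom W.obj)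
    (fun x y h => W.property.2 x y h) x) z)

instance : IsScalarTower k (RingQuot r) (Total W) where
  smul_assoc c x z := by
    change toEnd W (c • x) z = c • toEnd W x z
    rw [map_smul]
    rfl

instance : Module.Finite (RingQuot r) (Total W) := by
  have (v : Paths V) : Module.Finite k (W.obj.obj v) := W.property.1 v
  have : Module.Finite k (Total W) :=
    inferInstanceAs (Module.Finite k (∀ v : Paths V, W.obj.obj v))
  exact Module.Finite.of_restrictScalars_finite k _ _

variable {W} {W' : Rep r}

/-- The linear map induced by a morphism of representations. -/
noncomputable def map (f : W ⟶ W') : Total W →ₗ[RingQuot r] Total W' where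
  toFun z v := f.hom.app v (z v)
  map_add' z z' := funext fun v => map_add (f.hom.app v).hom _ _
  map_smul' x z := by
    obtain ⟨x, rfl⟩ := RingQuot.mkAlgHom_surjective k r x
    refine Eq.trans ?_ (mk_smul W' x _).symm
    refine Eq.trans ?_ (toEnd_naturality f.hom x z).symm
    rw [mk_smul]

end Total

variable (r) in
/-- The functor from representations to finitely generated modules over the bound path algebra. -/
noncomputable def totalFunctor : Rep r ⥤ FGModuleCat.{u} (RingQuot r) where
  obj W := FGModuleCat.of (RingQuot r) (Total W)
  map f := FGModuleCat.ofHom (Total.map f)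

namespace Total

/-- The inclusion of the vector space at a vertex. -/
noncomputable def single (W : Rep r) (v : Paths V) : W.obj.obj v →ₗ[k] Total W :=
  LinearMap.single k (fun v : Paths V => W.obj.obj v) v

/-- The projection to the vector space at a vertex. -/
noncomputable def proj (W : Rep r) (v : Paths V) : Total W →ₗ[k] W.obj.obj v :=
  LinearMap.proj (φ := fun v : Paths V => W.obj.obj v) v

variable {W W' : Rep r}

@[ext]
lemma ext {x y : Total W} (h : ∀ v, proj W v x = proj W v y) : x = y := funext h

@[simp]
lemma proj_single (v : Paths V) (x : W.obj.obj v) : proj W v (single W v x) = x :=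
  Pi.single_eq_same (M := fun v : Paths V => W.obj.obj v) v x

lemma sum_single (x : Total W) : ∑ v, single W v (proj W v x) = x :=
  Finset.univ_sum_single (M := fun v : Paths V => W.obj.obj v) x

variable (r) in
/-- The class of a path in the quotient of the path algebra. -/
noncomputable def pathClass {a b : Paths V} (p : a ⟶ b) : RingQuot r :=
  RingQuot.mkAlgHom k r (PathAlgebra.single (V := V) (a := a) (b := b) p)

lemma pathClass_smul {a b : Paths V} (p : a ⟶ b) (x : Total W) :
    pathClass r p • x = single W b (W.obj.map p (proj W a x)) :=
  (Total.mk_smul W _ x).trans (toEnd_single W.obj _ x)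

@[simp]
lemma proj_map (f : W ⟶ W') (v : Paths V) (x : Total W) :
    proj W' v (map f x) = f.hom.app v (proj W v x) := rfl

variable (f : Total W →ₗ[RingQuot r] Total W')

/-- A linear map commutes with the idempotents of the vertices, hence respects the
decomposition. -/
lemma linearMap_single (v : Paths V) (x : W.obj.obj v) :
    f (single W v x) = single W' v (proj W' v (f (single W v x))) := by
  have h : pathClass r (𝟙 v) • single W v x = single W v x := by simp [pathClass_smul]
  conv_lhs => rw [← h, map_smul, pathClass_smul]
  simp

/-- The morphism of representations underlying a linear map of the associated modules. -/
noncomputable def component : W ⟶ W' := ObjectProperty.homMk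
  { app v := ModuleCat.ofHom (proj W' v ∘ₗ f.restrictScalars k ∘ₗ single W v)
    naturality a b p := by
      ext x
      have h : pathClass r p • single W a x = single W b (W.obj.map p x) := by
        simp [pathClass_smul]
      change proj W' b (f (single W b (W.obj.map p x))) =
        W'.obj.map p (proj W' a (f (single W a x)))
      rw [← h, map_smul, pathClass_smul, proj_single] }

lemma map_component : map (component f) = f := by
  ext x v
  rw [proj_map]
  change proj W' v (f (single W v (proj W v x))) = _
  conv_rhs => rw [← sum_single x, map_sum, map_sum]
  rw [Finset.sum_eq_single v _ (by simp)]
  intro b _ hb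
  rw [linearMap_single]
  exact Pi.single_eq_of_ne (M := fun v : Paths V => W'.obj.obj v) hb.symm _

end Total

instance : (totalFunctor r).Faithful where
  map_injective {W W'} f g h := by
    ext v x
    have h₁ : Total.map f = Total.map g := congrArg (fun φ => φ.hom.hom) h
    simpa using congr(Total.proj W' v ($h₁ (Total.single W v x)))

instance : (totalFunctor r).Full where
  map_surjective {W W'} f := ⟨Total.component f.hom.hom, by
    ext1; exact Total.map_component f.hom.hom⟩

end PathAlgebra

/-! ### The representation of a module -/

namespace PathAlgebra

variable {k : Type u} [Field k] {V : Type} [Quiver.{0} V] [Fintype V] [DecidableEq V]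
  {r : PathAlgebra k V → PathAlgebra k V → Prop}

namespace Total

lemma pathClass_mul {a b c : Paths V} (p : a ⟶ b) (q : b ⟶ c) :
    pathClass r q * pathClass r p = pathClass r (p ≫ q) := by
  rw [pathClass, pathClass, ← map_mul]
  exact congrArg _ (single_mul_single (V := V) (a := a) (b := b) (c := c) q p)

lemma pathClass_mul_of_ne {a b c d : Paths V} (p : a ⟶ b) (q : c ⟶ d) (h : b ≠ c) :
    pathClass r q * pathClass r p = 0 := by
  rw [pathClass, pathClass, ← map_mul, ← map_zero (RingQuot.mkAlgHom k r)]
  exact congrArg _ (single_mul_single_of_ne (V := V) (a := c) (b := d) (c := a) (d := b) q p h)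

variable (V r) in
lemma sum_pathClass_id : ∑ v : Paths V, pathClass r (𝟙 v) = 1 := by
  rw [← map_one (RingQuot.mkAlgHom k r), one_def, map_sum]
  rfl

end Total

open Total

section Pieces

variable (r) (M : Type u) [AddCommGroup M] [Module (RingQuot r) M] [Module k M]
  [IsScalarTower k (RingQuot r) M]

/-- The part of a module cut out by the idempotent of a vertex `v`, that is, by the path of length
zero at `v`. -/
def piece (v : Paths V) : Submodule k M where
  carrier := {x | pathClass r (𝟙 v) • x = x}
  add_mem' hx hy := by
    simp only [Set.mem_ofPred_eq] at *
    rw [smul_add, hx, hy]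
  zero_mem' := smul_zero _
  smul_mem' c x hx := by
    simp only [Set.mem_ofPred_eq] at *
    rw [smul_comm, hx]

variable {M} in
lemma pathClass_smul_mem {a b : Paths V} (p : a ⟶ b) (x : M) :
    pathClass r p • x ∈ piece r M b := by
  change pathClass r (𝟙 b) • pathClass r p • x = _
  rw [smul_smul, pathClass_mul, Category.comp_id]

/-- The representation underlying a module. -/
noncomputable def pieceFunctor : Paths V ⥤ ModuleCat.{u} k where
  obj v := ModuleCat.of k (piece r M v)
  map {a b} p := ModuleCat.ofHom
    { toFun (x : piece r M a) :=
        (⟨pathClass r p • (x : M), pathClass_smul_mem r p (x : M)⟩ : piece r M b)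
      map_add' x y := Subtype.ext (smul_add (pathClass r p) (x : M) (y : M))
      map_smul' c x := Subtype.ext (smul_comm (pathClass r p) c (x : M)) }
  map_id v := by
    ext x
    exact x.2
  map_comp p q := by
    ext x
    change pathClass r (p ≫ q) • (x : M) = pathClass r q • pathClass r p • (x : M)
    rw [smul_smul, pathClass_mul]

/-- The inclusion of the piece at a vertex. -/
noncomputable def pieceIncl (v : Paths V) : (pieceFunctor r M).obj v →ₗ[k] M :=
  (piece r M v).subtype

variable {r M} in
lemma pathClass_smul_pieceIncl {v : Paths V} (x : (pieceFunctor r M).obj v) :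
    pathClass r (𝟙 v) • pieceIncl r M v x = pieceIncl r M v x := x.2

/-- The sum of the inclusions of the pieces. -/
noncomputable def pieceSum : (∀ v : Paths V, (pieceFunctor r M).obj v) →ₗ[k] M :=
  ∑ v : Paths V, pieceIncl r M v ∘ₗ
    LinearMap.proj (φ := fun v : Paths V => (pieceFunctor r M).obj v) v

lemma pieceSum_apply (x : ∀ v : Paths V, (pieceFunctor r M).obj v) :
    pieceSum r M x = ∑ v, pieceIncl r M v (x v) := by
  simp [pieceSum]

lemma pathClass_smul_pieceSum {a b : Paths V} (p : a ⟶ b)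
    (x : ∀ v : Paths V, (pieceFunctor r M).obj v) :
    pathClass r p • pieceSum r M x = pathClass r p • pieceIncl r M a (x a) := by
  rw [pieceSum_apply, Finset.smul_sum, Finset.sum_eq_single a _ (by simp)]
  intro v _ hv
  rw [← pathClass_smul_pieceIncl, smul_smul, pathClass_mul_of_ne _ _ hv, zero_smul]

lemma pieceSum_injective : Function.Injective (pieceSum r M) := by
  intro x y h
  funext v
  apply Subtype.ext
  change pieceIncl r M v (x v) = pieceIncl r M v (y v)
  rw [← pathClass_smul_pieceIncl, ← pathClass_smul_pieceIncl (y v), ← pathClass_smul_pieceSum,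
    ← pathClass_smul_pieceSum, h]

lemma pieceSum_surjective : Function.Surjective (pieceSum r M) := fun x =>
  ⟨fun v => (⟨pathClass r (𝟙 v) • x, pathClass_smul_mem r _ x⟩ : piece r M v), by
    refine (pieceSum_apply r M _).trans ?_
    change ∑ v : Paths V, pathClass r (𝟙 v) • x = x
    rw [← Finset.sum_smul, sum_pathClass_id, one_smul]⟩

lemma pieceSum_toEnd (x : PathAlgebra k V) (z : ∀ v : Paths V, (pieceFunctor r M).obj v) :
    pieceSum r M (toEnd (pieceFunctor r M) x z) = RingQuot.mkAlgHom k r x • pieceSum r M z := by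
  induction x using induction_linear with
  | zero => simp
  | add x x' hx hx' => rw [map_add, map_add, add_smul, ← hx, ← hx', LinearMap.add_apply, map_add]
  | smul c x hx => rw [map_smul, map_smul, smul_assoc, ← hx, LinearMap.smul_apply, map_smul]
  | @single a b p =>
    rw [toEnd_single]
    refine Eq.trans ?_ (pathClass_smul_pieceSum r M (a := a) (b := b) p z).symm
    rw [pieceSum_apply, Finset.sum_eq_single (show Paths V from b)]
    · exact congrArg (pieceIncl r M b) (Pi.single_eq_same
        (M := fun v : Paths V => (pieceFunctor r M).obj v) b _)
    · intro v _ hv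
      exact (congrArg (pieceIncl r M v) (Pi.single_eq_of_ne
        (M := fun v : Paths V => (pieceFunctor r M).obj v) hv _)).trans (map_zero _)
    · exact fun h => absurd (Finset.mem_univ _) h

lemma repProperty_pieceFunctor [Module.Finite k M] : repProperty r (pieceFunctor r M) :=
  ⟨fun v => inferInstanceAs (Module.Finite k (piece r M v)), fun x y h => by
    refine LinearMap.ext fun z => pieceSum_injective r M ?_
    rw [pieceSum_toEnd, pieceSum_toEnd, RingQuot.mkAlgHom_rel k h]⟩

/-- A module is the total space of the representation underlying it. -/
noncomputable def totalPieceEquiv [Module.Finite k M] :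
    Total (r := r) ⟨pieceFunctor r M, repProperty_pieceFunctor r M⟩ ≃ₗ[RingQuot r] M :=
  LinearEquiv.ofBijective (M := Total (r := r)
      ⟨pieceFunctor r M, repProperty_pieceFunctor r M⟩)
    { toFun := fun z => pieceSum r M z
      map_add' := map_add (pieceSum r M)
      map_smul' := fun y z => by
        obtain ⟨x, rfl⟩ := RingQuot.mkAlgHom_surjective k r y
        exact (congrArg (pieceSum r M) (mk_smul _ x z)).trans (pieceSum_toEnd r M x z) }
    ⟨pieceSum_injective r M, pieceSum_surjective r M⟩

end Pieces

variable [Module.Finite k (PathAlgebra k V)]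

instance : (totalFunctor r).EssSurj where
  mem_essImage M := by
    let _ : Module k M := Module.compHom M (algebraMap k (RingQuot r))
    have : IsScalarTower k (RingQuot r) M := ⟨fun c x m => by
      rw [Algebra.smul_def, mul_smul]
      rfl⟩
    have : Module.Finite k (RingQuot r) :=
      Module.Finite.of_surjective (RingQuot.mkAlgHom k r).toLinearMap
        (RingQuot.mkAlgHom_surjective k r)
    have : Module.Finite k M := Module.Finite.trans (RingQuot r) M
    exact ⟨⟨pieceFunctor r M, repProperty_pieceFunctor r M⟩,
      ⟨LinearEquiv.toFGModuleCatIso (totalPieceEquiv r M)⟩⟩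

instance : (totalFunctor r).IsEquivalence where

variable (r) in
/-- Finitely generated modules over a finite-dimensional bound path algebra are the same as
finite-dimensional representations of the bound quiver. -/
noncomputable def repEquivalence : Rep r ≌ FGModuleCat.{u} (RingQuot r) :=
  (totalFunctor r).asEquivalence

end PathAlgebra

/-! ### Exact functors to vector spaces -/

section Exactness

variable {A : Type*} [Category* A] [Abelian A] {k : Type u} [Field k]

/-- The objectwise direct sum of two functors to vector spaces, with the cartesian product as
underlying space. -/
noncomputable def directSumFunctor (E E' : A ⥤ ModuleCat.{u} k) : A ⥤ ModuleCat.{u} k where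
  obj X := ModuleCat.of k (E.obj X × E'.obj X)
  map f := ModuleCat.ofHom ((E.map f).hom.prodMap (E'.map f).hom)

/-- The zero functor, with the one-point space as value. -/
noncomputable abbrev punitFunctor : A ⥤ ModuleCat.{u} k :=
  (Functor.const A).obj (ModuleCat.of k PUnit.{u + 1})

instance : (punitFunctor (A := A) (k := k)).Additive where

instance (E E' : A ⥤ ModuleCat.{u} k) [E.Additive] [E'.Additive] :
    (directSumFunctor E E').Additive where
  map_add {X Y f g} := by
    ext x
    change (E.map (f + g) x.1, E'.map (f + g) x.2) =
      (E.map f x.1, E'.map f x.2) + (E.map g x.1, E'.map g x.2)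
    rw [E.map_add, E'.map_add]
    rfl

/-- The functor `F` preserves exactness of three-term complexes. For a functor into representations
this can be checked at each vertex. -/
def MapsExact {B : Type*} [Category* B] [Abelian B] (F : A ⥤ B) [F.Additive] : Prop :=
  ∀ S : ShortComplex A, S.Exact → (S.map F).Exact

lemma mapsExact_punitFunctor : MapsExact (punitFunctor (A := A) (k := k)) := fun S _ => by
  rw [ShortComplex.moduleCat_exact_iff]
  exact fun x _ => ⟨x, rfl⟩

lemma mapsExact_directSumFunctor {E E' : A ⥤ ModuleCat.{u} k} [E.Additive] [E'.Additive]
    (h : MapsExact E) (h' : MapsExact E') : MapsExact (directSumFunctor E E') := fun S hS => by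
  have h₁ := h S hS
  have h₂ := h' S hS
  rw [ShortComplex.moduleCat_exact_iff] at h₁ h₂ ⊢
  rintro ⟨x, y⟩ hxy
  obtain ⟨x', rfl⟩ := h₁ x (congrArg Prod.fst hxy)
  obtain ⟨y', rfl⟩ := h₂ y (congrArg Prod.snd hxy)
  exact ⟨(x', y'), rfl⟩

/-- The transformation out of a direct sum given by two transformations. -/
noncomputable def directSumDesc {E E' F : A ⥤ ModuleCat.{u} k} (f : E ⟶ F) (f' : E' ⟶ F) :
    directSumFunctor E E' ⟶ F where
  app X := ModuleCat.ofHom ((f.app X).hom.coprod (f'.app X).hom)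
  naturality X Y g := by
    ext ⟨x, y⟩
    have h₁ := congr($(f.naturality g) x)
    have h₂ := congr($(f'.naturality g) y)
    change f.app Y (E.map g x) = F.map g (f.app X x) at h₁
    change f'.app Y (E'.map g y) = F.map g (f'.app X y) at h₂
    change f.app Y (E.map g x) + f'.app Y (E'.map g y) = F.map g (f.app X x + f'.app X y)
    rw [h₁, h₂, map_add]

/-- The transformation into a direct sum given by two transformations. -/
noncomputable def directSumLift {E E' F : A ⥤ ModuleCat.{u} k} (f : F ⟶ E) (f' : F ⟶ E') :
    F ⟶ directSumFunctor E E' where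
  app X := ModuleCat.ofHom ((f.app X).hom.prod (f'.app X).hom)
  naturality X Y g := by
    ext x
    exact Prod.ext congr($(f.naturality g) x) congr($(f'.naturality g) x)

/-- The projection to the first summand. -/
noncomputable def directSumFst (E E' : A ⥤ ModuleCat.{u} k) : directSumFunctor E E' ⟶ E where
  app X := ModuleCat.ofHom (LinearMap.fst k (E.obj X) (E'.obj X))

/-- The projection to the second summand. -/
noncomputable def directSumSnd (E E' : A ⥤ ModuleCat.{u} k) : directSumFunctor E E' ⟶ E' where
  app X := ModuleCat.ofHom (LinearMap.snd k (E.obj X) (E'.obj X))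

end Exactness

/-! ### Constructions of representations, vertex by vertex -/

namespace PathAlgebra

variable {k : Type u} [Field k] {V : Type} [Quiver.{0} V] [DecidableEq V]
  {r : PathAlgebra k V → PathAlgebra k V → Prop}

variable (r) in
/-- The vector space at a vertex, as a functor on representations. -/
noncomputable def ev (v : V) : Rep r ⥤ ModuleCat.{u} k :=
  (repProperty r).ι ⋙ (evaluation (Paths V) (ModuleCat.{u} k)).obj v

instance : PreservesFiniteLimits (repProperty r).ι :=
  have := (repProperty r).preservesKernels_ι
  Functor.preservesFiniteLimits_of_preservesKernels _

instance : PreservesFiniteColimits (repProperty r).ι :=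
  have := (repProperty r).preservesCokernels_ι
  Functor.preservesFiniteColimits_of_preservesCokernels _

instance (v : V) : (ev r v).Additive :=
  have h (v : Paths V) :
      ((repProperty r).ι ⋙ (evaluation (Paths V) (ModuleCat.{u} k)).obj v).Additive := inferInstance
  h v

instance (v : V) : PreservesFiniteLimits (ev r v) :=
  have h (v : Paths V) : PreservesFiniteLimits
    ((repProperty r).ι ⋙ (evaluation (Paths V) (ModuleCat.{u} k)).obj v) := inferInstance
  h v

instance (v : V) : PreservesFiniteColimits (ev r v) :=
  have h (v : Paths V) : PreservesFiniteColimits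
    ((repProperty r).ι ⋙ (evaluation (Paths V) (ModuleCat.{u} k)).obj v) := inferInstance
  h v

lemma mapsExact_ev (v : V) : MapsExact (ev r v) := fun _ hS => hS.map (ev r v)

lemma isZero_of_ev (W : Rep r) (h : ∀ v, IsZero ((ev r v).obj W)) : IsZero W := by
  rw [IsZero.iff_id_eq_zero]
  ext v : 3
  exact (h v).eq_of_src _ _

lemma exact_of_ev (S : ShortComplex (Rep r)) (h : ∀ v, (S.map (ev r v)).Exact) : S.Exact := by
  rw [ShortComplex.exact_iff_isZero_homology]
  refine isZero_of_ev _ fun v => ?_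
  exact ((ShortComplex.exact_iff_isZero_homology _).1 (h v)).of_iso
    (S.mapHomologyIso (ev r v)).symm

lemma bicartesianSq_of_ev {W X Y Z : Rep r} {f : W ⟶ X} {g : W ⟶ Y} {h : X ⟶ Z} {i : Y ⟶ Z}
    (sq : ∀ v, BicartesianSq ((ev r v).map f) ((ev r v).map g) ((ev r v).map h)
      ((ev r v).map i)) : BicartesianSq f g h i := by
  have w : f ≫ h = g ≫ i := by
    ext v : 3
    exact (sq v).w
  have h₁ : IsPullback f g h i := IsPullback.of_map (repProperty r).ι w
    (.of_forall_isPullback_app fun v => (sq v).toIsPullback)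
  have h₂ : IsPushout f g h i := IsPushout.of_map (repProperty r).ι w
    (.of_forall_isPushout_app fun v => (sq v).toIsPushout)
  exact { h₁, h₂ with }

/-- The linear map by which an arrow acts in a representation. -/
noncomputable abbrev arr (W : Paths V ⥤ ModuleCat.{u} k) {a b : V} (e : a ⟶ b) :
    W.obj a →ₗ[k] W.obj b :=
  (W.map e.toPath.hom).hom

lemma toEnd_single_mul_single (W : Paths V ⥤ ModuleCat.{u} k) {a b c : V} (e : b ⟶ c) (f : a ⟶ b)
    (z : ∀ v : Paths V, W.obj v) :
    toEnd W (single e.toPath * single f.toPath) z =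
      Pi.single (M := fun v : Paths V => W.obj v) c (arr W e (arr W f (z a))) := by
  rw [single_mul_single, toEnd_single, Quiver.Path.hom_comp, W.map_comp]
  rfl

lemma toEnd_path_eq_iff (W : Paths V ⥤ ModuleCat.{u} k) {a b b' c : V} (e : b ⟶ c) (f : a ⟶ b)
    (e' : b' ⟶ c) (f' : a ⟶ b') :
    toEnd W (single e.toPath * single f.toPath) = toEnd W (single e'.toPath * single f'.toPath) ↔
      ∀ x, arr W e (arr W f x) = arr W e' (arr W f' x) := by
  constructor
  · intro h x
    have h₁ := LinearMap.congr_fun h (Pi.single (M := fun v : Paths V => W.obj v) a x)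
    rw [toEnd_single_mul_single, toEnd_single_mul_single] at h₁
    have h₂ := Pi.single_injective (M := fun v : Paths V => W.obj v) c h₁
    have h₃ := Pi.single_eq_same (M := fun v : Paths V => W.obj v) a x
    exact (congrArg (fun t => arr W e (arr W f t)) h₃).symm.trans
      (h₂.trans (congrArg (fun t => arr W e' (arr W f' t)) h₃))
  · intro h
    refine LinearMap.ext fun z => ?_
    rw [toEnd_single_mul_single, toEnd_single_mul_single, h]

variable (r) in
/-- The action of an arrow, as a natural transformation between the vector spaces at its ends. -/
noncomputable def evMap {a b : V} (e : a ⟶ b) :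
    ev r a ⟶ ev r b :=
  Functor.whiskerLeft (repProperty r).ι ((evaluation (Paths V) (ModuleCat.{u} k)).map e.toPath.hom)

variable {A : Type*} [Category* A] [Abelian A]

/-- A representation of the quiver by functors `A ⥤ ModuleCat k`, satisfying the relations at each
object of `A`, is a functor from `A` to the category of representations. -/
noncomputable def repFunctor (Φ : V ⥤q (A ⥤ ModuleCat.{u} k))
    (h : ∀ X, repProperty r ((Paths.lift Φ).flip.obj X)) : A ⥤ Rep r :=
  (repProperty r).lift (Paths.lift Φ).flip h

instance additive_repFunctor (Φ : V ⥤q (A ⥤ ModuleCat.{u} k))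
    (h : ∀ X, repProperty r ((Paths.lift Φ).flip.obj X)) [∀ v, (Φ.obj v).Additive] :
    (repFunctor Φ h).Additive where
  map_add {X Y f g} := by
    ext v : 3
    exact (Φ.obj (show V from v)).map_add

lemma mapsExact_repFunctor (Φ : V ⥤q (A ⥤ ModuleCat.{u} k))
    (h : ∀ X, repProperty r ((Paths.lift Φ).flip.obj X))
    [∀ v, (Φ.obj v).Additive] (hΦ' : ∀ v, MapsExact (Φ.obj v)) :
    MapsExact (repFunctor Φ h) := fun S hS =>
  exact_of_ev _ fun v => hΦ' v S hS

/-- A transformation between functors into representations is given by transformations at the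
vertices that are compatible with the arrows. -/
noncomputable def repNatTrans {F G : A ⥤ Rep r} (θ : ∀ v : V, F ⋙ ev r v ⟶ G ⋙ ev r v)
    (h : ∀ {a b : V} (e : a ⟶ b) (X : A) (x : (F.obj X).obj.obj a),
      arr (G.obj X).obj e ((θ a).app X x) = (θ b).app X (arr (F.obj X).obj e x)) : F ⟶ G where
  app X := (repProperty r).homMk (Paths.liftNatTrans (fun v : V => (θ v).app X) fun {a b} e => by
    ext x
    exact (h e X x).symm)
  naturality X Y f := by
    ext v : 3
    exact (θ v).naturality f

end PathAlgebra

lemma MapsExact.preserves {A B : Type*} [Category* A] [Category* B] [Abelian A] [Abelian B]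
    {F : A ⥤ B} [F.Additive] (h : MapsExact F) :
    PreservesFiniteLimits F ∧ PreservesFiniteColimits F :=
  ((Functor.exact_tfae F).out 1 3).1 h

open PathAlgebra

/-! ### The relations of `T` and `S` in terms of the arrows -/

lemma repProperty_tubularRel_iff {k : Type u} [Field k]
    (W : Paths TubularVertex ⥤ ModuleCat.{u} k) :
    repProperty (TubularRel k 0) W ↔ (∀ v, Module.Finite k (W.obj v)) ∧
      (∀ x, arr W (TubularArrow.b 0 : TubularVertex.mid 0 ⟶ .bot)
          (arr W (TubularArrow.a 0 : TubularVertex.top ⟶ .mid 0) x) =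
        arr W (TubularArrow.b 1 : TubularVertex.mid 1 ⟶ .bot)
          (arr W (TubularArrow.a 1 : TubularVertex.top ⟶ .mid 1) x) +
        arr W (TubularArrow.b 2 : TubularVertex.mid 2 ⟶ .bot)
          (arr W (TubularArrow.a 2 : TubularVertex.top ⟶ .mid 2) x)) ∧
      (∀ x, arr W (TubularArrow.b 0 : TubularVertex.mid 0 ⟶ .bot)
          (arr W (TubularArrow.a 0 : TubularVertex.top ⟶ .mid 0) x) =
        arr W (TubularArrow.b 3 : TubularVertex.mid 3 ⟶ .bot)
          (arr W (TubularArrow.a 3 : TubularVertex.top ⟶ .mid 3) x)) := by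
  refine and_congr_right fun _ => ?_
  have h₁ (i : Fin 4) (z) : toEnd W (tubularPath k i) z =
      Pi.single (M := fun v : Paths TubularVertex => W.obj v) TubularVertex.bot
        (arr W (TubularArrow.b i : TubularVertex.mid i ⟶ .bot)
          (arr W (TubularArrow.a i : TubularVertex.top ⟶ .mid i) (z TubularVertex.top))) :=
    toEnd_single_mul_single W _ _ z
  have h₂ : toEnd W (tubularPath k 0 - tubularPath k 1) = toEnd W (tubularPath k 2) ↔
      (∀ x, arr W (TubularArrow.b 0 : TubularVertex.mid 0 ⟶ .bot)
          (arr W (TubularArrow.a 0 : TubularVertex.top ⟶ .mid 0) x) =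
        arr W (TubularArrow.b 1 : TubularVertex.mid 1 ⟶ .bot)
          (arr W (TubularArrow.a 1 : TubularVertex.top ⟶ .mid 1) x) +
        arr W (TubularArrow.b 2 : TubularVertex.mid 2 ⟶ .bot)
          (arr W (TubularArrow.a 2 : TubularVertex.top ⟶ .mid 2) x)) := by
    rw [map_sub, sub_eq_iff_eq_add']
    constructor
    · intro h x
      have h₃ := LinearMap.congr_fun h
        (Pi.single (M := fun v : Paths TubularVertex => W.obj v) TubularVertex.top x)
      rw [LinearMap.add_apply, h₁, h₁, h₁] at h₃
      have h₄ := Pi.single_injective (M := fun v : Paths TubularVertex => W.obj v) _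
        (h₃.trans (Pi.single_add (f := fun v : Paths TubularVertex => W.obj v) _ _ _).symm)
      have h₅ := Pi.single_eq_same (M := fun v : Paths TubularVertex => W.obj v)
        TubularVertex.top x
      simpa only [h₅] using h₄
    · intro h
      refine LinearMap.ext fun z => ?_
      rw [LinearMap.add_apply, h₁, h₁, h₁, h]
      exact Pi.single_add (f := fun v : Paths TubularVertex => W.obj v) _ _ _
  have h₃ : toEnd W (tubularPath k 0 - (0 : k) • tubularPath k 1) = toEnd W (tubularPath k 3) ↔
      (∀ x, arr W (TubularArrow.b 0 : TubularVertex.mid 0 ⟶ .bot)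
          (arr W (TubularArrow.a 0 : TubularVertex.top ⟶ .mid 0) x) =
        arr W (TubularArrow.b 3 : TubularVertex.mid 3 ⟶ .bot)
          (arr W (TubularArrow.a 3 : TubularVertex.top ⟶ .mid 3) x)) := by
    rw [zero_smul, sub_zero]
    exact toEnd_path_eq_iff W _ _ _ _
  constructor
  · exact fun h => ⟨h₂.1 (h _ _ .rel₁), h₃.1 (h _ _ .rel₂)⟩
  · rintro ⟨h, h'⟩ _ _ (_ | _)
    exacts [h₂.2 h, h₃.2 h']

lemma repProperty_sphereRel_iff {k : Type u} [Field k]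
    (W : Paths SphereVertex ⥤ ModuleCat.{u} k) :
    repProperty (SphereRel k) W ↔ (∀ v, Module.Finite k (W.obj v)) ∧
      (∀ x, arr W (SphereArrow.dP : SphereVertex.midP ⟶ .snkM)
          (arr W (SphereArrow.aP : SphereVertex.srcP ⟶ .midP) x) =
        arr W (SphereArrow.bM : SphereVertex.midM ⟶ .snkM)
          (arr W (SphereArrow.cP : SphereVertex.srcP ⟶ .midM) x)) ∧
      (∀ x, arr W (SphereArrow.dM : SphereVertex.midM ⟶ .snkP)
          (arr W (SphereArrow.aM : SphereVertex.srcM ⟶ .midM) x) =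
        arr W (SphereArrow.bP : SphereVertex.midP ⟶ .snkP)
          (arr W (SphereArrow.cM : SphereVertex.srcM ⟶ .midP) x)) ∧
      (∀ x, arr W (SphereArrow.bP : SphereVertex.midP ⟶ .snkP)
          (arr W (SphereArrow.aP : SphereVertex.srcP ⟶ .midP) x) =
        arr W (SphereArrow.dM : SphereVertex.midM ⟶ .snkP)
          (arr W (SphereArrow.cP : SphereVertex.srcP ⟶ .midM) x)) ∧
      (∀ x, arr W (SphereArrow.bM : SphereVertex.midM ⟶ .snkM)
          (arr W (SphereArrow.aM : SphereVertex.srcM ⟶ .midM) x) =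
        arr W (SphereArrow.dP : SphereVertex.midP ⟶ .snkM)
          (arr W (SphereArrow.cM : SphereVertex.srcM ⟶ .midP) x)) := by
  refine and_congr_right fun _ => ?_
  rw [← toEnd_path_eq_iff, ← toEnd_path_eq_iff, ← toEnd_path_eq_iff, ← toEnd_path_eq_iff]
  constructor
  · exact fun h => ⟨h _ _ .rel₁, h _ _ .rel₂, h _ _ .rel₃, h _ _ .rel₄⟩
  · rintro ⟨h₁, h₂, h₃, h₄⟩ _ _ (_ | _ | _ | _)
    exacts [h₁, h₂, h₃, h₄]

open PathAlgebra

/-! ### Diagrams on the two quivers -/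

section Diagrams

/-- The diagram on the quiver of `T` with the given objects and arrows. -/
def tubularPrefunctor {C : Type*} [Category* C] {X Y M₀ M₁ M₂ M₃ : C} (a₀ : X ⟶ M₀) (a₁ : X ⟶ M₁)
    (a₂ : X ⟶ M₂) (a₃ : X ⟶ M₃) (b₀ : M₀ ⟶ Y) (b₁ : M₁ ⟶ Y) (b₂ : M₂ ⟶ Y) (b₃ : M₃ ⟶ Y) :
    TubularVertex ⥤q C where
  obj
    | .top => X
    | .mid 0 => M₀
    | .mid 1 => M₁
    | .mid 2 => M₂
    | .mid 3 => M₃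
    | .bot => Y
  map
    | .a 0 => a₀
    | .a 1 => a₁
    | .a 2 => a₂
    | .a 3 => a₃
    | .b 0 => b₀
    | .b 1 => b₁
    | .b 2 => b₂
    | .b 3 => b₃

/-- The diagram on the quiver of `S` with the given objects and arrows. -/
def spherePrefunctor {C : Type*} [Category* C] {X X' Y Y' Z Z' : C} (aP : X ⟶ Y) (aM : X' ⟶ Y')
    (cP : X ⟶ Y') (cM : X' ⟶ Y) (bP : Y ⟶ Z) (bM : Y' ⟶ Z') (dP : Y ⟶ Z') (dM : Y' ⟶ Z) :
    SphereVertex ⥤q C where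
  obj
    | .srcP => X
    | .srcM => X'
    | .midP => Y
    | .midM => Y'
    | .snkP => Z
    | .snkM => Z'
  map
    | .aP => aP
    | .aM => aM
    | .cP => cP
    | .cM => cM
    | .bP => bP
    | .bM => bM
    | .dP => dP
    | .dM => dM

lemma TubularVertex.forall {P : TubularVertex → Prop} (h : P .top) (h₀ : P (.mid 0))
    (h₁ : P (.mid 1)) (h₂ : P (.mid 2)) (h₃ : P (.mid 3)) (h' : P .bot)
    (v : TubularVertex) : P v := by
  match v with
  | .top => exact h
  | .mid 0 => exact h₀
  | .mid 1 => exact h₁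
  | .mid 2 => exact h₂
  | .mid 3 => exact h₃
  | .bot => exact h'

lemma SphereVertex.forall {P : SphereVertex → Prop} (h₁ : P .srcP) (h₂ : P .srcM)
    (h₃ : P .midP) (h₄ : P .midM) (h₅ : P .snkP) (h₆ : P .snkM) (v : SphereVertex) : P v := by
  cases v <;> assumption

end Diagrams

/-! ### Representations of the two bound quivers -/

variable (k : Type u) [Field k]

/-- The category of finite-dimensional representations of the bound quiver of `T`. -/
noncomputable abbrev TubularRep := Rep (TubularRel k 0)
/-- The category of finite-dimensional representations of the bound quiver of `S`. -/
noncomputable abbrev SphereRep := Rep (SphereRel k)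

noncomputable section

variable {k}

/-- The vector space at a vertex of a representation of `S`. -/
abbrev evS (v : SphereVertex) : SphereRep k ⥤ ModuleCat.{u} k := ev (SphereRel k) v
/-- The vector space at a vertex of a representation of `T`. -/
abbrev evT (v : TubularVertex) : TubularRep k ⥤ ModuleCat.{u} k := ev (TubularRel k 0) v
/-- The action of an arrow on representations of `S`. -/
abbrev mapS {v w : SphereVertex} (e : SphereArrow v w) : evS (k := k) v ⟶ evS w :=
  evMap (SphereRel k) (show v ⟶ w from e)
/-- The action of an arrow on representations of `T`. -/
abbrev mapT {v w : TubularVertex} (e : TubularArrow v w) : evT (k := k) v ⟶ evT w :=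
  evMap (TubularRel k 0) (show v ⟶ w from e)

open SphereVertex SphereArrow TubularVertex TubularArrow

namespace SphereRep
variable (X : SphereRep k)

lemma finite (v : SphereVertex) : Module.Finite k ((evS v).obj X) := X.property.1 v

lemma rel_dP_aP (x : (evS srcP).obj X) :
    (mapS dP).app X ((mapS aP).app X x) = (mapS bM).app X ((mapS cP).app X x) :=
  ((repProperty_sphereRel_iff _).1 X.property).2.1 x

lemma rel_dM_aM (x : (evS srcM).obj X) :
    (mapS dM).app X ((mapS aM).app X x) = (mapS bP).app X ((mapS cM).app X x) :=
  ((repProperty_sphereRel_iff _).1 X.property).2.2.1 x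

lemma rel_bP_aP (x : (evS srcP).obj X) :
    (mapS bP).app X ((mapS aP).app X x) = (mapS dM).app X ((mapS cP).app X x) :=
  ((repProperty_sphereRel_iff _).1 X.property).2.2.2.1 x

lemma rel_bM_aM (x : (evS srcM).obj X) :
    (mapS bM).app X ((mapS aM).app X x) = (mapS dP).app X ((mapS cM).app X x) :=
  ((repProperty_sphereRel_iff _).1 X.property).2.2.2.2 x

end SphereRep

namespace TubularRep
variable (X : TubularRep k)

lemma finite (v : TubularVertex) : Module.Finite k ((evT v).obj X) := X.property.1 v

lemma rel_add (x : (evT top).obj X) :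
    (mapT (b 0)).app X ((mapT (a 0)).app X x) = (mapT (b 1)).app X ((mapT (a 1)).app X x) +
      (mapT (b 2)).app X ((mapT (a 2)).app X x) :=
  ((repProperty_tubularRel_iff _).1 X.property).2.1 x

lemma rel_eq (x : (evT top).obj X) :
    (mapT (b 0)).app X ((mapT (a 0)).app X x) = (mapT (b 3)).app X ((mapT (a 3)).app X x) :=
  ((repProperty_tubularRel_iff _).1 X.property).2.2 x

end TubularRep

/-! ### The four exact functors -/

/-- The values of `cospanTubular` at the vertices. -/
def cospanTubularData : TubularVertex ⥤q (SphereRep k ⥤ ModuleCat.{u} k) :=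
  tubularPrefunctor (directSumDesc (mapS aP) (mapS cM)) (directSumFst (evS srcP) (evS srcM))
    (directSumSnd _ _) (directSumDesc (mapS aP) (mapS cM)) (𝟙 _) (mapS aP) (mapS cM) (𝟙 _)

/-- The exact functor from representations of `S` to those of `T` that depends only on the cospan
`1₊ ⟶ 2₊ ⟵ 1₋` of a representation `X`: `m₁` and `m₂` carry `X(1₊)` and `X(1₋)`, the source carries
their direct sum, and the other three vertices carry `X(2₊)`. -/
def cospanTubular : SphereRep k ⥤ TubularRep k :=
  repFunctor cospanTubularData fun X => by
    rw [repProperty_tubularRel_iff]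
    refine ⟨TubularVertex.forall ?_ ?_ ?_ ?_ ?_ ?_, fun _ => rfl, fun _ => rfl⟩
    · have := X.finite srcP
      have := X.finite srcM
      exact inferInstanceAs (Module.Finite k ((evS srcP).obj X × (evS srcM).obj X))
    exacts [X.finite _, X.finite _, X.finite _, X.finite _, X.finite _]

/-- The values of `forkTubular` at the vertices. -/
def forkTubularData : TubularVertex ⥤q (SphereRep k ⥤ ModuleCat.{u} k) :=
  tubularPrefunctor (X := evS midM) (Y := punitFunctor) (M₁ := punitFunctor) (M₂ := punitFunctor)
    (mapS dM) 0 0 (mapS bM) 0 0 0 0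

/-- The exact functor from representations of `S` to those of `T` that places the fork
`3₊ ⟵ 2₋ ⟶ 3₋` of a representation at `m₀ ⟵ top ⟶ m₃`. -/
def forkTubular : SphereRep k ⥤ TubularRep k :=
  repFunctor forkTubularData fun X => by
    rw [repProperty_tubularRel_iff]
    refine ⟨TubularVertex.forall ?_ ?_ ?_ ?_ ?_ ?_, fun _ => rfl, fun _ => rfl⟩
    exacts [X.finite _, X.finite _, inferInstanceAs (Module.Finite k PUnit.{u + 1}),
      inferInstanceAs (Module.Finite k PUnit.{u + 1}), X.finite _,
      inferInstanceAs (Module.Finite k PUnit.{u + 1})]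

/-- The values of `forkSphere` at the vertices. -/
def forkSphereData : SphereVertex ⥤q (TubularRep k ⥤ ModuleCat.{u} k) :=
  spherePrefunctor (X := punitFunctor) (X' := punitFunctor) (Y := punitFunctor) (Y' := evT top)
    0 0 0 0 0 (mapT (a 3)) 0 (mapT (a 0))

/-- The exact functor from representations of `T` to those of `S` that places the fork
`m₀ ⟵ top ⟶ m₃` of a representation at `3₊ ⟵ 2₋ ⟶ 3₋`. -/
def forkSphere : TubularRep k ⥤ SphereRep k :=
  repFunctor forkSphereData fun X => by
    rw [repProperty_sphereRel_iff]
    refine ⟨SphereVertex.forall ?_ ?_ ?_ ?_ ?_ ?_, fun _ => ?_, fun _ => ?_, fun _ => ?_,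
      fun _ => ?_⟩
    exacts [inferInstanceAs (Module.Finite k PUnit.{u + 1}),
      inferInstanceAs (Module.Finite k PUnit.{u + 1}),
      inferInstanceAs (Module.Finite k PUnit.{u + 1}), X.finite _, X.finite _, X.finite _,
      (map_zero ((mapT (a 3)).app X).hom).symm, map_zero ((mapT (a 0)).app X).hom,
      (map_zero ((mapT (a 0)).app X).hom).symm, map_zero ((mapT (a 3)).app X).hom]

/-- The values of `cospanSphere` at the vertices. -/
def cospanSphereData : SphereVertex ⥤q (TubularRep k ⥤ ModuleCat.{u} k) :=
  spherePrefunctor (mapT (b 1)) (directSumLift 0 (𝟙 (evT (mid 2))))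
    (directSumLift (𝟙 (evT (mid 1))) 0) (mapT (b 2)) (𝟙 _) (directSumDesc (mapT (b 1)) (mapT (b 2)))
    (𝟙 _) (directSumDesc (mapT (b 1)) (mapT (b 2)))

/-- The exact functor from representations of `T` to those of `S` that depends only on the cospan
`m₁ ⟶ bot ⟵ m₂` of a representation `Y`: it is placed at `1₊ ⟶ 2₊ ⟵ 1₋`, the vertex `2₋` carries
`Y(m₁) ⊕ Y(m₂)`, and `3₊` and `3₋` carry `Y(bot)`. -/
def cospanSphere : TubularRep k ⥤ SphereRep k :=
  repFunctor cospanSphereData fun X => by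
    have h (x : (evT (mid 1)).obj X) : (mapT (b 1)).app X x =
        (mapT (b 1)).app X x + (mapT (b 2)).app X 0 := by simp
    have h' (y : (evT (mid 2)).obj X) : (mapT (b 1)).app X 0 + (mapT (b 2)).app X y =
        (mapT (b 2)).app X y := by simp
    rw [repProperty_sphereRel_iff]
    refine ⟨SphereVertex.forall ?_ ?_ ?_ ?_ ?_ ?_, h, h', h, h'⟩
    · exact X.finite _
    · exact X.finite _
    · exact X.finite _
    · have := X.finite (mid 1)
      have := X.finite (mid 2)
      exact inferInstanceAs (Module.Finite k ((evT (mid 1)).obj X × (evT (mid 2)).obj X))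
    · exact X.finite _
    · exact X.finite _

instance (v : TubularVertex) : (cospanTubularData (k := k).obj v).Additive :=
  TubularVertex.forall (P := fun v => (cospanTubularData (k := k).obj v).Additive)
    (inferInstanceAs (directSumFunctor _ _).Additive)
    (inferInstanceAs (evS _).Additive) (inferInstanceAs (evS _).Additive)
    (inferInstanceAs (evS _).Additive) (inferInstanceAs (evS _).Additive)
    (inferInstanceAs (evS _).Additive) v

instance : (cospanTubular (k := k)).Additive := additive_repFunctor _ _

instance (v : TubularVertex) : (forkTubularData (k := k).obj v).Additive :=
  TubularVertex.forall (P := fun v => (forkTubularData (k := k).obj v).Additive)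
    (inferInstanceAs (evS _).Additive)
    (inferInstanceAs (evS _).Additive) (inferInstanceAs punitFunctor.Additive)
    (inferInstanceAs punitFunctor.Additive) (inferInstanceAs (evS _).Additive)
    (inferInstanceAs punitFunctor.Additive) v

instance : (forkTubular (k := k)).Additive := additive_repFunctor _ _

instance (v : SphereVertex) : (forkSphereData (k := k).obj v).Additive :=
  SphereVertex.forall (P := fun v => (forkSphereData (k := k).obj v).Additive)
    (inferInstanceAs punitFunctor.Additive)
    (inferInstanceAs punitFunctor.Additive) (inferInstanceAs punitFunctor.Additive)
    (inferInstanceAs (evT _).Additive) (inferInstanceAs (evT _).Additive)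
    (inferInstanceAs (evT _).Additive) v

instance : (forkSphere (k := k)).Additive := additive_repFunctor _ _

instance (v : SphereVertex) : (cospanSphereData (k := k).obj v).Additive :=
  SphereVertex.forall (P := fun v => (cospanSphereData (k := k).obj v).Additive)
    (inferInstanceAs (evT _).Additive)
    (inferInstanceAs (evT _).Additive) (inferInstanceAs (evT _).Additive)
    (inferInstanceAs (directSumFunctor _ _).Additive) (inferInstanceAs (evT _).Additive)
    (inferInstanceAs (evT _).Additive) v

instance : (cospanSphere (k := k)).Additive := additive_repFunctor _ _

lemma mapsExact_cospanTubular : MapsExact (cospanTubular (k := k)) :=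
  mapsExact_repFunctor _ _ (TubularVertex.forall
    (mapsExact_directSumFunctor (mapsExact_ev _) (mapsExact_ev _)) (mapsExact_ev _)
    (mapsExact_ev _) (mapsExact_ev _) (mapsExact_ev _) (mapsExact_ev _))

lemma mapsExact_forkTubular : MapsExact (forkTubular (k := k)) :=
  mapsExact_repFunctor _ _ (TubularVertex.forall (mapsExact_ev _) (mapsExact_ev _)
    mapsExact_punitFunctor mapsExact_punitFunctor (mapsExact_ev _) mapsExact_punitFunctor)

lemma mapsExact_forkSphere : MapsExact (forkSphere (k := k)) :=
  mapsExact_repFunctor _ _ (SphereVertex.forall mapsExact_punitFunctor mapsExact_punitFunctor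
    mapsExact_punitFunctor (mapsExact_ev _) (mapsExact_ev _) (mapsExact_ev _))

lemma mapsExact_cospanSphere : MapsExact (cospanSphere (k := k)) :=
  mapsExact_repFunctor _ _ (SphereVertex.forall (mapsExact_ev _) (mapsExact_ev _)
    (mapsExact_ev _) (mapsExact_directSumFunctor (mapsExact_ev _) (mapsExact_ev _))
    (mapsExact_ev _) (mapsExact_ev _))

instance : PreservesFiniteLimits (cospanTubular (k := k)) := mapsExact_cospanTubular.preserves.1
instance : PreservesFiniteColimits (cospanTubular (k := k)) := mapsExact_cospanTubular.preserves.2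
instance : PreservesFiniteLimits (forkTubular (k := k)) := mapsExact_forkTubular.preserves.1
instance : PreservesFiniteColimits (forkTubular (k := k)) := mapsExact_forkTubular.preserves.2
instance : PreservesFiniteLimits (forkSphere (k := k)) := mapsExact_forkSphere.preserves.1
instance : PreservesFiniteColimits (forkSphere (k := k)) := mapsExact_forkSphere.preserves.2
instance : PreservesFiniteLimits (cospanSphere (k := k)) := mapsExact_cospanSphere.preserves.1
instance : PreservesFiniteColimits (cospanSphere (k := k)) := mapsExact_cospanSphere.preserves.2

/-! ### The natural transformations -/

/-- The components of `cospanToForkTubular` at the vertices. -/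
def cospanToForkTubularApp : ∀ v : TubularVertex,
    cospanTubular (k := k) ⋙ evT v ⟶ forkTubular ⋙ evT v
  | .top => directSumDesc (mapS cP) (mapS aM)
  | .mid 0 => mapS bP
  | .mid 1 => (0 : evS srcP ⟶ punitFunctor)
  | .mid 2 => (0 : evS srcM ⟶ punitFunctor)
  | .mid 3 => mapS dP
  | .bot => (0 : evS midP ⟶ punitFunctor)

/-- The transformation given by the four arrows of `S` that connect the cospan to the fork. -/
def cospanToForkTubular : cospanTubular (k := k) ⟶ forkTubular :=
  repNatTrans cospanToForkTubularApp fun e X => match e with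
    | .a 0 => fun x => by
      change (mapS dM).app X ((mapS cP).app X x.1 + (mapS aM).app X x.2) =
        (mapS bP).app X ((mapS aP).app X x.1 + (mapS cM).app X x.2)
      rw [map_add, map_add, X.rel_bP_aP, X.rel_dM_aM]
    | .a 1 => fun _ => rfl
    | .a 2 => fun _ => rfl
    | .a 3 => fun x => by
      change (mapS bM).app X ((mapS cP).app X x.1 + (mapS aM).app X x.2) =
        (mapS dP).app X ((mapS aP).app X x.1 + (mapS cM).app X x.2)
      rw [map_add, map_add, X.rel_dP_aP, X.rel_bM_aM]
    | .b 0 => fun _ => rfl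
    | .b 1 => fun _ => rfl
    | .b 2 => fun _ => rfl
    | .b 3 => fun _ => rfl

/-- The components of `forkToCospanSphere` at the vertices. -/
def forkToCospanSphereApp : ∀ v : SphereVertex,
    forkSphere (k := k) ⋙ evS v ⟶ cospanSphere ⋙ evS v
  | .srcP => (0 : punitFunctor ⟶ evT (mid 1))
  | .srcM => (0 : punitFunctor ⟶ evT (mid 2))
  | .midP => (0 : punitFunctor ⟶ evT bot)
  | .midM => directSumLift (mapT (a 1)) (mapT (a 2))
  | .snkP => mapT (b 0)
  | .snkM => mapT (b 3)

/-- The transformation given by the four arrows of `T` that connect the fork to the cospan. -/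
def forkToCospanSphere : forkSphere (k := k) ⟶ cospanSphere :=
  repNatTrans forkToCospanSphereApp fun e X => match e with
    | .aP => fun _ => map_zero ((mapT (b 1)).app X).hom
    | .aM => fun _ => Prod.ext (Eq.symm (map_zero ((mapT (a 1)).app X).hom))
      (Eq.symm (map_zero ((mapT (a 2)).app X).hom))
    | .cP => fun _ => Prod.ext (Eq.symm (map_zero ((mapT (a 1)).app X).hom))
      (Eq.symm (map_zero ((mapT (a 2)).app X).hom))
    | .cM => fun _ => map_zero ((mapT (b 2)).app X).hom
    | .bP => fun _ => (map_zero ((mapT (b 0)).app X).hom).symm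
    | .bM => fun x => (X.rel_add x).symm.trans (X.rel_eq x)
    | .dP => fun _ => (map_zero ((mapT (b 3)).app X).hom).symm
    | .dM => fun x => (X.rel_add x).symm

/-- The components of `forkForkToId` at the vertices. -/
def forkForkToIdApp : ∀ v : SphereVertex,
    (forkTubular (k := k) ⋙ forkSphere) ⋙ evS v ⟶ 𝟭 _ ⋙ evS v
  | .srcP => (0 : punitFunctor ⟶ evS srcP)
  | .srcM => (0 : punitFunctor ⟶ evS srcM)
  | .midP => (0 : punitFunctor ⟶ evS midP)
  | .midM => 𝟙 (evS midM)
  | .snkP => 𝟙 (evS snkP)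
  | .snkM => 𝟙 (evS snkM)

/-- The inclusion of the fork of a representation of `S`, a subrepresentation. -/
def forkForkToId : forkTubular (k := k) ⋙ forkSphere ⟶ 𝟭 _ :=
  repNatTrans forkForkToIdApp fun e X => match e with
    | .aP => fun _ => map_zero ((mapS aP).app X).hom
    | .aM => fun _ => map_zero ((mapS aM).app X).hom
    | .cP => fun _ => map_zero ((mapS cP).app X).hom
    | .cM => fun _ => map_zero ((mapS cM).app X).hom
    | .bP => fun _ => map_zero ((mapS bP).app X).hom
    | .bM => fun _ => rfl
    | .dP => fun _ => map_zero ((mapS dP).app X).hom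
    | .dM => fun _ => rfl

/-- The components of `cospanCospanToId` at the vertices. -/
def cospanCospanToIdApp : ∀ v : SphereVertex,
    (cospanTubular (k := k) ⋙ cospanSphere) ⋙ evS v ⟶ 𝟭 _ ⋙ evS v
  | .srcP => 𝟙 (evS srcP)
  | .srcM => 𝟙 (evS srcM)
  | .midP => 𝟙 (evS midP)
  | .midM => directSumDesc (mapS cP) (mapS aM)
  | .snkP => mapS bP
  | .snkM => mapS dP

/-- The transformation that is the identity on the cospan; at the vertices of the fork it is given
by the arrows that connect the cospan to the fork. -/
def cospanCospanToId : cospanTubular (k := k) ⋙ cospanSphere ⟶ 𝟭 _ :=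
  repNatTrans cospanCospanToIdApp fun e X => match e with
    | .aP => fun _ => rfl
    | .aM => fun x => by
      change (mapS aM).app X x = (mapS cP).app X 0 + (mapS aM).app X x
      simp
    | .cP => fun x => by
      change (mapS cP).app X x = (mapS cP).app X x + (mapS aM).app X 0
      simp
    | .cM => fun _ => rfl
    | .bP => fun _ => rfl
    | .bM => fun (x : (evS srcP).obj X × (evS srcM).obj X) => by
      change (mapS bM).app X ((mapS cP).app X x.1 + (mapS aM).app X x.2) =
        (mapS dP).app X ((mapS aP).app X x.1 + (mapS cM).app X x.2)
      rw [map_add, map_add, X.rel_dP_aP, X.rel_bM_aM]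
    | .dP => fun _ => rfl
    | .dM => fun (x : (evS srcP).obj X × (evS srcM).obj X) => by
      change (mapS dM).app X ((mapS cP).app X x.1 + (mapS aM).app X x.2) =
        (mapS bP).app X ((mapS aP).app X x.1 + (mapS cM).app X x.2)
      rw [map_add, map_add, X.rel_bP_aP, X.rel_dM_aM]

/-- The components of `idToCospanCospan` at the vertices. -/
def idToCospanCospanApp : ∀ v : TubularVertex,
    𝟭 (TubularRep k) ⋙ evT v ⟶ (cospanSphere ⋙ cospanTubular) ⋙ evT v
  | .top => directSumLift (mapT (a 1)) (mapT (a 2))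
  | .mid 0 => mapT (b 0)
  | .mid 1 => 𝟙 (evT (mid 1))
  | .mid 2 => 𝟙 (evT (mid 2))
  | .mid 3 => mapT (b 3)
  | .bot => 𝟙 (evT bot)

/-- The transformation that is the identity on the cospan; at the vertices of the fork it is given
by the arrows that connect the fork to the cospan. -/
def idToCospanCospan : 𝟭 (TubularRep k) ⟶ cospanSphere ⋙ cospanTubular :=
  repNatTrans idToCospanCospanApp fun e X => match e with
    | .a 0 => fun x => (X.rel_add x).symm
    | .a 1 => fun _ => rfl
    | .a 2 => fun _ => rfl
    | .a 3 => fun x => (X.rel_add x).symm.trans (X.rel_eq x)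
    | .b 0 => fun _ => rfl
    | .b 1 => fun _ => rfl
    | .b 2 => fun _ => rfl
    | .b 3 => fun _ => rfl

/-- The components of `idToForkFork` at the vertices. -/
def idToForkForkApp : ∀ v : TubularVertex,
    𝟭 (TubularRep k) ⋙ evT v ⟶ (forkSphere ⋙ forkTubular) ⋙ evT v
  | .top => 𝟙 (evT top)
  | .mid 0 => 𝟙 (evT (mid 0))
  | .mid 1 => (0 : evT (mid 1) ⟶ punitFunctor)
  | .mid 2 => (0 : evT (mid 2) ⟶ punitFunctor)
  | .mid 3 => 𝟙 (evT (mid 3))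
  | .bot => (0 : evT bot ⟶ punitFunctor)

/-- The projection of a representation of `T` onto its fork, a quotient representation. -/
def idToForkFork : 𝟭 (TubularRep k) ⟶ forkSphere ⋙ forkTubular :=
  repNatTrans idToForkForkApp fun e _ => match e with
    | .a 0 => fun _ => rfl
    | .a 1 => fun _ => rfl
    | .a 2 => fun _ => rfl
    | .a 3 => fun _ => rfl
    | .b 0 => fun _ => rfl
    | .b 1 => fun _ => rfl
    | .b 2 => fun _ => rfl
    | .b 3 => fun _ => rfl

/-! ### The bicartesian squares -/

lemma isZero_cospanSphere_forkTubular (X : SphereRep k) :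
    IsZero (cospanSphere.obj (forkTubular.obj X)) :=
  isZero_of_ev _ (SphereVertex.forall
    (ModuleCat.isZero_of_subsingleton (ModuleCat.of k PUnit.{u + 1}))
    (ModuleCat.isZero_of_subsingleton (ModuleCat.of k PUnit.{u + 1}))
    (ModuleCat.isZero_of_subsingleton (ModuleCat.of k PUnit.{u + 1}))
    (ModuleCat.isZero_of_subsingleton (ModuleCat.of k (PUnit.{u + 1} × PUnit.{u + 1})))
    (ModuleCat.isZero_of_subsingleton (ModuleCat.of k PUnit.{u + 1}))
    (ModuleCat.isZero_of_subsingleton (ModuleCat.of k PUnit.{u + 1})))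

lemma isZero_cospanTubular_forkSphere (X : TubularRep k) :
    IsZero (cospanTubular.obj (forkSphere.obj X)) :=
  isZero_of_ev _ (TubularVertex.forall
    (ModuleCat.isZero_of_subsingleton (ModuleCat.of k (PUnit.{u + 1} × PUnit.{u + 1})))
    (ModuleCat.isZero_of_subsingleton (ModuleCat.of k PUnit.{u + 1}))
    (ModuleCat.isZero_of_subsingleton (ModuleCat.of k PUnit.{u + 1}))
    (ModuleCat.isZero_of_subsingleton (ModuleCat.of k PUnit.{u + 1}))
    (ModuleCat.isZero_of_subsingleton (ModuleCat.of k PUnit.{u + 1}))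
    (ModuleCat.isZero_of_subsingleton (ModuleCat.of k PUnit.{u + 1})))

lemma bicartesianSq_of_bijective_vert {W X Y Z : ModuleCat.{u} k} {f : W ⟶ X} {g : W ⟶ Y}
    {h : X ⟶ Z} {i : Y ⟶ Z} (w : ∀ x, h (f x) = i (g x)) (hg : Function.Bijective g)
    (hh : Function.Bijective h) : BicartesianSq f g h i := by
  have := (ConcreteCategory.isIso_iff_bijective g).2 hg
  have := (ConcreteCategory.isIso_iff_bijective h).2 hh
  have sq : CommSq f g h i := ⟨by ext x; exact w x⟩
  exact { IsPullback.of_vert_isIso sq, IsPushout.of_vert_isIso sq with }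

lemma bicartesianSq_of_bijective_horiz {W X Y Z : ModuleCat.{u} k} {f : W ⟶ X} {g : W ⟶ Y}
    {h : X ⟶ Z} {i : Y ⟶ Z} (w : ∀ x, h (f x) = i (g x)) (hf : Function.Bijective f)
    (hi : Function.Bijective i) : BicartesianSq f g h i := by
  have := (ConcreteCategory.isIso_iff_bijective f).2 hf
  have := (ConcreteCategory.isIso_iff_bijective i).2 hi
  have sq : CommSq f g h i := ⟨by ext x; exact w x⟩
  exact { IsPullback.of_horiz_isIso sq, IsPushout.of_horiz_isIso sq with }

/-- At the vertices of the fork the vertical maps are identities, at the others the horizontal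
maps are identities. -/
lemma bicartesianSq_sphere (X : SphereRep k) :
    BicartesianSq (forkSphere.map (cospanToForkTubular.app X))
      (forkToCospanSphere.app (cospanTubular.obj X)) (forkForkToId.app X)
      (cospanCospanToId.app X) :=
  bicartesianSq_of_ev (SphereVertex.forall
    (bicartesianSq_of_bijective_horiz (fun _ => rfl) Function.bijective_id Function.bijective_id)
    (bicartesianSq_of_bijective_horiz (fun _ => rfl) Function.bijective_id Function.bijective_id)
    (bicartesianSq_of_bijective_horiz (fun _ => rfl) Function.bijective_id Function.bijective_id)
    (bicartesianSq_of_bijective_vert (fun _ => rfl) Function.bijective_id Function.bijective_id)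
    (bicartesianSq_of_bijective_vert (fun _ => rfl) Function.bijective_id Function.bijective_id)
    (bicartesianSq_of_bijective_vert (fun _ => rfl) Function.bijective_id Function.bijective_id))

/-- At the vertices of the fork the vertical maps are bijective, at the others the horizontal maps
are bijective. -/
lemma bicartesianSq_tubular (X : TubularRep k) :
    BicartesianSq (idToCospanCospan.app X) (idToForkFork.app X)
      (cospanToForkTubular.app (cospanSphere.obj X))
      (forkTubular.map (forkToCospanSphere.app X)) := by
  -- at `top`, the right vertical map is `(x, y) ↦ (x, 0) + (0, y)`
  have h (x : (evT (mid 1)).obj X × (evT (mid 2)).obj X) : (x.1, 0) + (0, x.2) = x := by simp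
  have h' : (fun x : (evT (mid 1)).obj X × (evT (mid 2)).obj X =>
      ((x.1, 0) + (0, x.2) : (evT (mid 1)).obj X × (evT (mid 2)).obj X)) = id := funext h
  exact bicartesianSq_of_ev (TubularVertex.forall
    (bicartesianSq_of_bijective_vert (fun _ => h _) Function.bijective_id
      (h' ▸ Function.bijective_id :))
    (bicartesianSq_of_bijective_vert (fun _ => rfl) Function.bijective_id Function.bijective_id)
    (bicartesianSq_of_bijective_horiz (fun _ => rfl) Function.bijective_id Function.bijective_id)
    (bicartesianSq_of_bijective_horiz (fun _ => rfl) Function.bijective_id Function.bijective_id)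
    (bicartesianSq_of_bijective_vert (fun _ => rfl) Function.bijective_id Function.bijective_id)
    (bicartesianSq_of_bijective_horiz (fun _ => rfl) Function.bijective_id Function.bijective_id))

end

noncomputable instance : HasDerivedCategory (TubularRep k) := HasDerivedCategory.standard _
noncomputable instance : HasDerivedCategory (SphereRep k) := HasDerivedCategory.standard _

lemma boundedEquivalent_tubularRep_sphereRep :
    DerivedCategory.BoundedEquivalent (TubularRep k) (SphereRep k) :=
  NatTrans.boundedEquivalent_of_bicartesianSq cospanToForkTubular forkToCospanSphere
    isZero_cospanSphere_forkTubular isZero_cospanTubular_forkSphere bicartesianSq_sphere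
    bicartesianSq_tubular

end

theorem propositionP (k : Type u) [Field k] :
    DerivedEquivalent (DegenerateTubularAlgebra k) (SphereAlgebra k) :=
  ((PathAlgebra.repEquivalence (TubularRel k 0)).symm.boundedEquivalent.trans
    (boundedEquivalent_tubularRep_sphereRep k)).trans
    (PathAlgebra.repEquivalence (SphereRel k)).boundedEquivalent
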